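/- Let $d\ge 0$ and $N\ge 1$ be integers, and let $p$ be the transition kernel of a Markov chain on $E=\mathbb{Z}^d\times\{1,\dots,N\}$, i.e. $p(u,v)\ge 0$ and $\sum_{v\in E}p(u,v)=1$ for all $u\in E$. Let $p^{(n)}$ denote the $n$-step transition probabilities, with $p^{(0)}(u,v)=1$ if $u=v$ and $0$ otherwise. Assume that the chain is - irreducible: for all $u,v\in E$ there is $n\ge 0$ with $p^{(n)}(u,v)>0$; - $\mathbb{Z}^d$-invariant: $p((z+x,k),(z+y,j))=p((x,k),(y,j))$ for all $x,y,z\in\mathbb{Z}^d$ and $k,j\in\{1,\dots,N\}$; - finitely supported: for every $u\in E$ the set $\{v\in E : p(u,v)>0\}$ is finite. The chain is called transient if its Green function $G(u,v)=\sum_{n\ge 0}p^{(n)}(u,v)$ is finite for all $u,v\in E$. Then the induced chain on the levels $\{1,\dots,N\}$, with transition probabilities $(k,j)\mapsto\sum_{x\in\mathbb{Z}^d}p((0,k),(x,j))$, has a unique stationary probability measure $\nu_0$. Put $$\overrightarrow{p}=\sum_{x\in\mathbb{Z}^d}\ \sum_{k,j\in\{1,\dots,N\}}\nu_0(k)\,p((0,k),(x,j))\,x\in\mathbb{R}^d,$$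 and call the chain centered if $\overrightarrow{p}=0$ and non-centered otherwise. Then: 1. If $d\ge 3$, the chain is transient. 2. If $d\le 2$, the chain is transient if and only if it is non-centered. -/

import Mathlib

open scoped ENNReal

/-- `Chain.nStep p n x y` is the probability `p⁽ⁿ⁾(x, y)` that the Markov chain with transition
kernel `p` goes from `x` to `y` in exactly `n` steps; `p⁽⁰⁾(x, ·)` is the point mass at `x`. -/
noncomputable def Chain.nStep {E : Type*} (p : E → PMF E) : ℕ → E → PMF E
  | 0, x => PMF.pure x
  | n + 1, x => (p x).bind (Chain.nStep p n)

/-- The Green function `G(x, y) = ∑ₙ p⁽ⁿ⁾(x, y)`, with values in `[0, ∞]`. -/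
noncomputable def Chain.green {E : Type*} (p : E → PMF E) (x y : E) : ℝ≥0∞ :=
  ∑' n : ℕ, Chain.nStep p n x y

/-- Every state can be reached from every state with positive probability. -/
def Chain.Irreducible {E : Type*} (p : E → PMF E) : Prop :=
  ∀ x y : E, ∃ n : ℕ, 0 < Chain.nStep p n x y

/-- The Green function is everywhere finite. -/
def Chain.Transient {E : Type*} (p : E → PMF E) : Prop :=
  ∀ x y : E, Chain.green p x y < ∞

/-- From every state only finitely many states are reached in one step. -/
def Chain.FinitelySupported {E : Type*} (p : E → PMF E) : Prop :=
  ∀ x : E, (p x).support.Finite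

/-- A probability measure `ν` is stationary for `p` if `∑ₓ ν(x) p(x, y) = ν(y)` for all `y`. -/
def Chain.IsStationary {E : Type*} (p : E → PMF E) (ν : PMF E) : Prop :=
  ν.bind p = ν

/-- The thickened lattice `ℤᵈ × {1, ..., N}`, with the levels indexed by `Fin N`. -/
abbrev ThickLattice (d N : ℕ) : Type := (Fin d → ℤ) × Fin N

/-- Invariance of the kernel under the translation action of `ℤᵈ` on `ℤᵈ × {1, ..., N}`. -/
def ThickLattice.Invariant {d N : ℕ} (p : ThickLattice d N → PMF (ThickLattice d N)) : Prop :=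
  ∀ (z x y : Fin d → ℤ) (k j : Fin N), p (z + x, k) (z + y, j) = p (x, k) (y, j)

/-- The induced chain on the set of levels, `k, j ↦ ∑ₓ p((0, k), (x, j))`. -/
noncomputable def ThickLattice.levelChain {d N : ℕ}
    (p : ThickLattice d N → PMF (ThickLattice d N)) (k : Fin N) : PMF (Fin N) :=
  (p (0, k)).map Prod.snd

/-- The average horizontal displacement `∑ₓ ∑ₖ ∑ⱼ ν(k) p((0, k), (x, j)) x`, a vector of `ℝᵈ`.
The sum over `x` has finitely many nonzero terms when `p` is finitely supported. -/
noncomputable def ThickLattice.drift {d N : ℕ}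
    (p : ThickLattice d N → PMF (ThickLattice d N)) (ν : PMF (Fin N)) : Fin d → ℝ :=
  ∑' x : Fin d → ℤ, ∑ k : Fin N, ∑ j : Fin N,
    ((ν k).toReal * (p (0, k) (x, j)).toReal) • (fun i : Fin d => (x i : ℝ))

/-! Both directions rest on superharmonic test functions. An irreducible chain is transient once
some function bounded below is strictly superharmonic on a nonempty sublevel set
(`Irreducible.transient_of_superharmonic`). A chain is not transient if some function with finite
sublevel sets is strictly superharmonic off a finite set
(`FinitelySupported.not_transient_of_lyapunov`). It remains to build such functions of the position
x and the level k.

The level chain is a finite irreducible chain with stationary law ν, and every function of the level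
with ν-mean zero is in the range of its generator (`LevelIrreducible.exists_levelGenerator_eq`).
Adding a suitable function of the level therefore replaces any level-dependent mean by its
ν-average.

If the drift is nonzero, let ℓ be the linear form x ↦ -⟨drift, x⟩. For a suitable g and small ε > 0,
the positive function exp(ε ℓ(x)) (1 + ε g(k)) is strictly superharmonic everywhere.

If the drift is zero, some x + g(k) is a martingale, and in suitable linear coordinates y the
averaged covariance of its increments is the identity. Put q = |y|² + a(k), and let c be a quadratic
form in y, depending on k, that cancels the fluctuation of the covariance between levels. Then ψ(q)
+ 2ψ''(q)c has one-step mean change at most dψ'(q) + 2qψ''(q) + O(q^(-3/2))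
(`exists_lyapunov_estimate`), which is the radial Laplacian up to a factor 2. The choice ψ = log log
t makes this negative at infinity for d ≤ 2, and ψ = t^(-1/4) does so for d ≥ 3. The first function
tends to infinity and gives recurrence; the second is positive and tends to 0, and gives transience.
-/

namespace Chain

/-! ### Green functions and superharmonic criteria for general chains. -/

variable {E : Type*} {p : E → PMF E}

lemma nStep_succ_apply (n : ℕ) (u v : E) :
    nStep p (n + 1) u v = ∑' w, p u w * nStep p n w v := by
  simp [nStep, PMF.bind_apply]

lemma green_eq (u v : E) :
    green p u v = PMF.pure u v + ∑' w, p u w * green p w v := by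
  unfold green
  rw [tsum_eq_zero_add' ENNReal.summable]
  congr 1
  simp_rw [nStep_succ_apply, ← ENNReal.tsum_mul_left]
  exact ENNReal.tsum_comm

lemma nStep_mul_le (m n : ℕ) (u w v : E) :
    nStep p m u w * nStep p n w v ≤ nStep p (m + n) u v := by
  induction m generalizing u with
  | zero =>
    by_cases h : w = u
    · subst h; simp [nStep]
    · simp [nStep, h]
  | succ m ih =>
    rw [Nat.succ_add, nStep_succ_apply, nStep_succ_apply, ← ENNReal.tsum_mul_right]
    refine ENNReal.tsum_le_tsum fun x => ?_
    rw [mul_assoc]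
    gcongr
    exact ih x

/-- One finite column of the Green function suffices: continuing paths from w to v gives G(u,w)
p⁽ⁿ⁾(w,v) ≤ G(u,v), and irreducibility makes the second factor positive for some n. -/
lemma Irreducible.transient_of_green_lt (hirr : Irreducible p) {v : E}
    (h : ∀ u, green p u v < ∞) : Transient p := by
  intro u w
  obtain ⟨n, hn⟩ := hirr w v
  have key : green p u w * nStep p n w v ≤ green p u v := by
    unfold green
    rw [← ENNReal.tsum_mul_right]
    calc _ ≤ ∑' m, nStep p (m + n) u v := ENNReal.tsum_le_tsum fun m => nStep_mul_le m n u w v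
      _ ≤ _ := ENNReal.tsum_comp_le_tsum_of_injective (add_left_injective n)
        (fun m => nStep p m u v)
  by_contra hc
  have : green p u w = ∞ := not_lt_top_iff.mp hc
  rw [this, ENNReal.top_mul hn.ne'] at key
  exact absurd (h u) (not_lt.mpr key)

/-- Iterating h ≥ e + Ph gives h ≥ e + Pe + ... + Pⁿe, and only the contribution of the single state
v is kept. The induction on partial sums peels off the first step. -/
lemma green_mul_le {h e : E → ℝ≥0∞} (H : ∀ u, e u + ∑' v, p u v * h v ≤ h u) (u v : E) :
    green p u v * e v ≤ h u := by
  have key : ∀ (M : ℕ) (u : E), ∑ n ∈ Finset.range M, nStep p n u v * e v ≤ h u := by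
    intro M
    induction M with
    | zero => simp
    | succ M ih =>
      intro u
      rw [Finset.sum_range_succ', add_comm]
      refine le_trans (add_le_add ?_ ?_) (H u)
      · by_cases h : v = u
        · subst h; simp [nStep]
        · simp [nStep, h]
      · simp_rw [nStep_succ_apply, ← ENNReal.tsum_mul_right]
        rw [← Summable.tsum_finsetSum (fun _ _ => ENNReal.summable)]
        refine ENNReal.tsum_le_tsum fun w => ?_
        simp_rw [mul_assoc]
        rw [← Finset.mul_sum]
        gcongr
        exact ih w
  unfold green
  rw [← ENNReal.tsum_mul_right, ENNReal.tsum_eq_iSup_nat]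
  exact iSup_le fun M => key M u

/-- A set that is closed under the transitions of positive probability is closed under paths. -/
lemma mem_of_nStep_pos {C : Set E} (hC : ∀ u ∈ C, ∀ v, 0 < p u v → v ∈ C) {n : ℕ} {u v : E}
    (hu : u ∈ C) (h : 0 < nStep p n u v) : v ∈ C := by
  induction n generalizing u with
  | zero =>
    by_cases huv : v = u
    · rwa [huv]
    · simp [nStep, huv] at h
  | succ n ih =>
    rw [nStep_succ_apply] at h
    obtain ⟨w, hw⟩ : ∃ w, p u w * nStep p n w v ≠ 0 := by
      by_contra! hc
      simp [hc] at h
    have h1 := left_ne_zero_of_mul hw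
    have h2 := right_ne_zero_of_mul hw
    exact ih (hC u hu w (pos_iff_ne_zero.mpr h1)) (pos_iff_ne_zero.mpr h2)

/-- The mean of `f` after one step of the chain started at `u`. -/
noncomputable def mean (p : E → PMF E) (f : E → ℝ) (u : E) : ℝ :=
  ∑' v, (p u v).toReal * f v

lemma mean_eq_sum {u : E} {S : Finset E} (hS : (p u).support ⊆ S) (f : E → ℝ) :
    mean p f u = ∑ v ∈ S, (p u v).toReal * f v := by
  refine tsum_eq_sum fun v hv => ?_
  have : p u v = 0 := by
    by_contra h
    exact hv (hS h)
  simp [this]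

lemma sum_toReal_eq_one {u : E} {S : Finset E} (hS : (p u).support ⊆ S) :
    ∑ v ∈ S, (p u v).toReal = 1 := by
  rw [← ENNReal.toReal_sum fun v _ => (p u).apply_ne_top v, ← tsum_eq_sum (L := .unconditional E), PMF.tsum_coe]
  · simp
  · intro v hv
    by_contra h
    exact hv (hS h)

namespace FinitelySupported

variable (hfin : FinitelySupported p)
include hfin

lemma exists_finset (u : E) : ∃ S : Finset E, (p u).support ⊆ S :=
  ⟨(hfin u).toFinset, by simp⟩

lemma mean_mono {f g : E → ℝ} (h : ∀ v, f v ≤ g v) (u : E) : mean p f u ≤ mean p g u := by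
  obtain ⟨S, hS⟩ := hfin.exists_finset u
  rw [mean_eq_sum hS, mean_eq_sum hS]
  gcongr
  exact h _

lemma mean_const (c : ℝ) (u : E) : mean p (fun _ => c) u = c := by
  obtain ⟨S, hS⟩ := hfin.exists_finset u
  rw [mean_eq_sum hS, ← Finset.sum_mul, sum_toReal_eq_one hS, one_mul]

lemma mean_add (f g : E → ℝ) (u : E) :
    mean p (fun v => f v + g v) u = mean p f u + mean p g u := by
  obtain ⟨S, hS⟩ := hfin.exists_finset u
  simp_rw [mean_eq_sum hS, mul_add, Finset.sum_add_distrib]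

lemma mean_const_mul (c : ℝ) (f : E → ℝ) (u : E) :
    mean p (fun v => c * f v) u = c * mean p f u := by
  obtain ⟨S, hS⟩ := hfin.exists_finset u
  simp_rw [mean_eq_sum hS, Finset.mul_sum, mul_left_comm]

lemma tsum_mul_ofReal {f : E → ℝ} (hf : ∀ v, 0 ≤ f v) (u : E) :
    ∑' v, p u v * ENNReal.ofReal (f v) = ENNReal.ofReal (mean p f u) := by
  obtain ⟨S, hS⟩ := hfin.exists_finset u
  rw [mean_eq_sum hS, ENNReal.ofReal_sum_of_nonneg fun v _ =>
    mul_nonneg ENNReal.toReal_nonneg (hf v), tsum_eq_sum]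
  · refine Finset.sum_congr rfl fun v _ => ?_
    rw [ENNReal.ofReal_mul ENNReal.toReal_nonneg, ENNReal.ofReal_toReal ((p u).apply_ne_top v)]
  · intro v hv
    have : p u v = 0 := by
      by_contra h
      exact hv (hS h)
    simp [this]

end FinitelySupported

/-- Each visit to u costs at least f u - mean p f u, while the total budget from w is f w - b;
`green_mul_le` thus bounds G(w,u). -/
lemma Irreducible.transient_of_forall_mean_le (hirr : Irreducible p)
    (hfin : FinitelySupported p) {f : E → ℝ} {b : ℝ}
    (hb : ∀ v, b ≤ f v) (hf : ∀ v, mean p f v ≤ f v) {u : E} (hu : mean p f u < f u) :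
    Transient p := by
  refine hirr.transient_of_green_lt (v := u) fun w => ?_
  have key := green_mul_le (p := p) (h := fun v => ENNReal.ofReal (f v + -b))
    (e := fun v => ENNReal.ofReal (f v - mean p f v)) (fun v => ?_) w u
  · by_contra hc
    have : green p w u = ∞ := not_lt_top_iff.mp hc
    rw [this, ENNReal.top_mul (by simpa using hu)] at key
    exact ENNReal.ofReal_ne_top (top_le_iff.mp key)
  · have hb' : ∀ v, 0 ≤ f v + -b := fun v => by linarith [hb v]
    have h1 : b ≤ mean p f v := by
      rw [← hfin.mean_const b v]
      exact hfin.mean_mono hb v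
    rw [hfin.tsum_mul_ofReal hb', hfin.mean_add, hfin.mean_const, ← ENNReal.ofReal_add]
    · apply ENNReal.ofReal_le_ofReal
      linarith
    · linarith [hf v]
    · linarith

/-- An irreducible chain with a function bounded below which is strictly superharmonic on a
nonempty sublevel set is transient. -/
theorem Irreducible.transient_of_superharmonic (hirr : Irreducible p)
    (hfin : FinitelySupported p) {f : E → ℝ} {b m : ℝ} (hb : ∀ v, b ≤ f v)
    (hf : ∀ v, f v < m → mean p f v < f v) {u : E} (hu : f u < m) : Transient p := by
  -- Truncation at m keeps strict superharmonicity where f < m. Elsewhere the truncated function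
  -- takes its maximal value m, so it is superharmonic there too.
  have hle : ∀ v, mean p (fun w => min (f w) m) v ≤ mean p f v := fun v =>
    hfin.mean_mono (fun w => min_le_left _ _) v
  refine hirr.transient_of_forall_mean_le hfin (f := fun v => min (f v) m) (b := min b m)
    (u := u) (fun v => min_le_min_right _ (hb v)) (fun v => ?_) ?_
  · refine le_min ?_ ?_
    · by_cases hv : f v < m
      · exact (hle v).trans (hf v hv).le
      · calc _ ≤ mean p (fun _ => m) v := hfin.mean_mono (fun w => min_le_right _ _) v
          _ = m := hfin.mean_const m v
          _ ≤ f v := not_lt.mp hv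
    · calc _ ≤ mean p (fun _ => m) v := hfin.mean_mono (fun w => min_le_right _ _) v
          _ = m := hfin.mean_const m v
  · rw [min_eq_left hu.le]
    exact (hle u).trans_lt (hf u hu)

-- The expected number of visits to A, as a function of the start, is superharmonic, and harmonic
-- off A. This is first-step analysis; transience makes the values real numbers.
open Classical in
lemma Transient.mean_green (ht : Transient p) (hfin : FinitelySupported p) (A : Finset E) (u : E) :
    mean p (fun w => ∑ v ∈ A, (green p w v).toReal) u + (if u ∈ A then 1 else 0)
      = ∑ v ∈ A, (green p u v).toReal := by
  have h1 : ∀ v, (green p u v).toReal =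
      (if v = u then 1 else 0) + mean p (fun w => (green p w v).toReal) u := by
    intro v
    obtain ⟨S, hS⟩ := hfin.exists_finset u
    rw [green_eq, ENNReal.toReal_add, mean_eq_sum hS, tsum_eq_sum (s := S),
      ENNReal.toReal_sum]
    · simp [PMF.pure_apply]
      split_ifs <;> simp
    · intro w _
      exact ENNReal.mul_ne_top ((p u).apply_ne_top w) (ht w v).ne
    · intro w hw
      have : p u w = 0 := by
        by_contra h
        exact hw (hS h)
      simp [this]
    · exact (PMF.pure u).apply_ne_top v
    · have := (ht u v).ne
      rw [green_eq] at this
      exact fun h => this (by simp [h])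
  simp_rw [h1, Finset.sum_add_distrib]
  obtain ⟨S, hS⟩ := hfin.exists_finset u
  have h2 : ∑ v ∈ A, (if v = u then (1 : ℝ) else 0) = if u ∈ A then 1 else 0 := by
    rw [Finset.sum_ite_eq']
  rw [h2, add_comm]
  simp_rw [mean_eq_sum hS, Finset.mul_sum]
  rw [Finset.sum_comm]

/-- A chain with a function with finite sublevel sets which is strictly superharmonic outside a
finite set is not transient. -/
theorem FinitelySupported.not_transient_of_lyapunov [Nonempty E] (hfin : FinitelySupported p)
    {f : E → ℝ} (hf : ∀ c, {v | f v ≤ c}.Finite) {A : Set E} (hA : A.Finite)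
    (hfA : ∀ v ∉ A, mean p f v < f v) : ¬ Transient p := by
  classical
  intro ht
  obtain ⟨o⟩ := ‹Nonempty E›
  set B : Finset E := insert o hA.toFinset with hB
  have hBne : B.Nonempty := ⟨o, by simp [hB]⟩
  set w : E → ℝ := fun u => ∑ v ∈ B, (green p u v).toReal with hw
  have hw0 : ∀ u, 0 ≤ w u := fun u => Finset.sum_nonneg fun v _ => ENNReal.toReal_nonneg
  have hmean : ∀ u, mean p w u + (if u ∈ B then 1 else 0) = w u := ht.mean_green hfin B
  obtain ⟨a, haB, ha⟩ := B.exists_min_image w hBne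
  -- Minimum principle: w is harmonic off B, so its minimum over B should be global. If w u < w a,
  -- the perturbation w + ε f has finite sublevel sets, hence a global minimum, which cannot lie off
  -- B by strict superharmonicity.
  have hmin : ∀ u, w a ≤ w u := by
    intro u
    by_contra! hlt
    -- σ exceeds f u - f b for every b in B. With ε = (w a - w u)/σ the perturbed value at u is then
    -- below all those on B, so the minimum cannot lie in B either.
    set σ : ℝ := 1 + ∑ b ∈ B, |f u - f b| with hσ
    have hσ0 : 0 < σ := by
      have : 0 ≤ ∑ b ∈ B, |f u - f b| := Finset.sum_nonneg fun _ _ => abs_nonneg _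
      linarith
    set ε := (w a - w u) / σ with hε
    have hε0 : 0 < ε := div_pos (by linarith) hσ0
    have hεσ : ε * σ = w a - w u := by rw [hε]; field_simp
    set Φ : E → ℝ := fun v => w v + ε * f v with hΦ
    have hfinite : {v | Φ v ≤ Φ u}.Finite := by
      refine (hf (Φ u / ε)).subset fun v hv => ?_
      simp only [Set.mem_ofPred_eq] at hv ⊢
      rw [le_div_iff₀ hε0]
      have := hw0 v
      simp only [hΦ] at hv ⊢
      linarith
    obtain ⟨x, hx, hxmin⟩ := Set.exists_min_image _ Φ hfinite ⟨u, le_refl (Φ u)⟩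
    have hglob : ∀ v, Φ x ≤ Φ v := by
      intro v
      by_cases hv : Φ v ≤ Φ u
      · exact hxmin v hv
      · exact le_trans hx (not_le.mp hv).le
    have hxB : x ∉ B := by
      intro hxB
      have h1 : |f u - f x| ≤ ∑ b ∈ B, |f u - f b| :=
        Finset.single_le_sum (f := fun b => |f u - f b|) (fun _ _ => abs_nonneg _) hxB
      have h2 : f u - f x < σ := by linarith [le_abs_self (f u - f x)]
      have h3 := mul_lt_mul_of_pos_left h2 hε0
      have h4 := ha x hxB
      have h5 : Φ x ≤ Φ u := hx
      simp only [hΦ] at h5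
      nlinarith
    have hxA : x ∉ A := fun h => hxB (by simp [hB, h])
    have h1 : Φ x ≤ mean p Φ x := by
      conv_lhs => rw [← hfin.mean_const (Φ x) x]
      exact hfin.mean_mono hglob x
    have h2 : mean p Φ x = mean p w x + ε * mean p f x := by
      rw [← hfin.mean_const_mul, ← hfin.mean_add]
    have h3 := hmean x
    rw [if_neg hxB, add_zero] at h3
    have h4 := mul_lt_mul_of_pos_left (hfA x hxA) hε0
    rw [h2, h3] at h1
    simp only [hΦ] at h1
    linarith
  -- At the global minimum a, which lies in B, the mean after one step is w a - 1: a contradiction.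
  have h1 : w a ≤ mean p w a := by
    conv_lhs => rw [← hfin.mean_const (w a) a]
    exact hfin.mean_mono hmin a
  have h2 := hmean a
  rw [if_pos haB] at h2
  linarith

end Chain

/-! ### Transition data and the Poisson equation on the levels. -/

/-- The transition data of a translation invariant chain on `ℤᵈ × {1, ..., N}`: from `(x, k)` the
chain jumps to `(x + z, j)` with probability `weight k (z, j)`, where `(z, j)` ranges over the
finite set `steps`. -/
structure LatticeWalk (d N : ℕ) where
  steps : Finset (ThickLattice d N)
  weight : Fin N → ThickLattice d N → ℝ
  weight_nonneg : ∀ k s, 0 ≤ weight k s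
  sum_weight : ∀ k, ∑ s ∈ steps, weight k s = 1

namespace LatticeWalk

variable {d N : ℕ} (W : LatticeWalk d N)

/-- The expectation of a function of the step made from level `k`. -/
def stepMean (k : Fin N) (F : ThickLattice d N → ℝ) : ℝ :=
  ∑ s ∈ W.steps, W.weight k s * F s

lemma stepMean_add (k : Fin N) (F G : ThickLattice d N → ℝ) :
    W.stepMean k (fun s => F s + G s) = W.stepMean k F + W.stepMean k G := by
  simp_rw [stepMean, mul_add, Finset.sum_add_distrib]

lemma stepMean_const_mul (k : Fin N) (c : ℝ) (F : ThickLattice d N → ℝ) :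
    W.stepMean k (fun s => c * F s) = c * W.stepMean k F := by
  simp_rw [stepMean, Finset.mul_sum, mul_left_comm]

lemma stepMean_const (k : Fin N) (c : ℝ) : W.stepMean k (fun _ => c) = c := by
  rw [stepMean, ← Finset.sum_mul, W.sum_weight, one_mul]

lemma stepMean_sub (k : Fin N) (F G : ThickLattice d N → ℝ) :
    W.stepMean k (fun s => F s - G s) = W.stepMean k F - W.stepMean k G := by
  simp_rw [stepMean, mul_sub, Finset.sum_sub_distrib]

lemma stepMean_sum {ι : Type*} (k : Fin N) (t : Finset ι) (F : ι → ThickLattice d N → ℝ) :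
    W.stepMean k (fun s => ∑ i ∈ t, F i s) = ∑ i ∈ t, W.stepMean k (F i) := by
  simp_rw [stepMean, Finset.mul_sum]
  exact Finset.sum_comm

lemma stepMean_mono (k : Fin N) {F G : ThickLattice d N → ℝ} (h : ∀ s ∈ W.steps, F s ≤ G s) :
    W.stepMean k F ≤ W.stepMean k G :=
  Finset.sum_le_sum fun s hs => mul_le_mul_of_nonneg_left (h s hs) (W.weight_nonneg k s)

lemma eq_zero_of_stepMean_eq_zero {k : Fin N} {F : ThickLattice d N → ℝ}
    (h0 : ∀ s ∈ W.steps, 0 ≤ F s) (h : W.stepMean k F = 0) {s : ThickLattice d N}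
    (hs : s ∈ W.steps) (hw : 0 < W.weight k s) : F s = 0 := by
  have := (Finset.sum_eq_zero_iff_of_nonneg fun s hs =>
    mul_nonneg (W.weight_nonneg k s) (h0 s hs)).mp h s hs
  exact (mul_eq_zero.mp this).resolve_left hw.ne'

/-- The generator of the induced chain on the levels. -/
def levelGenerator : (Fin N → ℝ) →ₗ[ℝ] (Fin N → ℝ) where
  toFun g k := W.stepMean k (fun s => g s.2) - g k
  map_add' g h := by
    ext k
    simp only [Pi.add_apply, stepMean_add]
    ring
  map_smul' c g := by
    ext k
    simp only [Pi.smul_apply, smul_eq_mul, stepMean_const_mul, RingHom.id_apply]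
    ring

lemma levelGenerator_apply (g : Fin N → ℝ) (k : Fin N) :
    W.levelGenerator g k = W.stepMean k (fun s => g s.2) - g k := rfl

/-- Only the full set of levels is nonempty and closed under transitions. -/
def LevelIrreducible : Prop :=
  ∀ D : Set (Fin N), D.Nonempty → (∀ k ∈ D, ∀ s ∈ W.steps, 0 < W.weight k s → s.2 ∈ D) →
    ∀ k, k ∈ D

/-- The vector `ν` is an invariant probability vector of the induced chain on the levels. -/
def IsLevelStationary (ν : Fin N → ℝ) : Prop :=
  ∑ k, ν k = 1 ∧ ∀ g, ∑ k, ν k * W.levelGenerator g k = 0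

variable {W}

/-- Maximum principle: the set where g is maximal is closed under transitions. -/
lemma LevelIrreducible.eq_of_levelGenerator_eq_zero (hW : W.LevelIrreducible) {g : Fin N → ℝ}
    (hg : W.levelGenerator g = 0) (k j : Fin N) : g k = g j := by
  have : Nonempty (Fin N) := ⟨k⟩
  obtain ⟨o, ho⟩ := Finite.exists_max g
  have key : ∀ k, k ∈ {k | g k = g o} := by
    refine hW _ ⟨o, rfl⟩ fun k hk s hs hw => ?_
    have h1 := congrFun hg k
    rw [levelGenerator_apply, Pi.zero_apply] at h1
    have h2 : W.stepMean k (fun s => g o - g s.2) = 0 := by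
      rw [stepMean_sub, stepMean_const, ← hk]
      linarith
    have := W.eq_zero_of_stepMean_eq_zero (fun s _ => sub_nonneg.mpr (ho s.2)) h2 hs hw
    simp only [Set.mem_ofPred_eq]
    linarith
  exact (key k).trans (key j).symm

lemma levelGenerator_const (c : ℝ) : W.levelGenerator (fun _ => c) = 0 := by
  ext k
  simp [levelGenerator_apply, stepMean_const]

lemma stepMean_comp_snd (g : Fin N → ℝ) (k : Fin N) :
    W.stepMean k (fun s => g s.2) =
      ∑ j, W.stepMean k (fun s => if s.2 = j then 1 else 0) * g j := by
  have : (fun s : ThickLattice d N => g s.2) =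
      fun s => ∑ j, g j * (if s.2 = j then 1 else 0) := by
    ext s; simp
  rw [this, stepMean_sum]
  simp_rw [stepMean_const_mul, mul_comm]

lemma sum_mul_levelGenerator (ν g : Fin N → ℝ) :
    ∑ k, ν k * W.levelGenerator g k =
      ∑ j, (∑ k, ν k * W.stepMean k (fun s => if s.2 = j then 1 else 0) - ν j) * g j := by
  simp_rw [levelGenerator_apply, mul_sub, sub_mul, Finset.sum_sub_distrib, stepMean_comp_snd g,
    Finset.mul_sum, Finset.sum_mul, ← mul_assoc]
  rw [Finset.sum_comm]

/-- The generator kills constants, so it is not surjective, and a nonzero functional μ annihilates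
its range: a signed invariant vector. The triangle inequality gives |μ| ≤ |μ|Q entrywise, and both
sides have the same total because Q is stochastic. Hence |μ| is invariant; its support is closed
under transitions, so it is everything. -/
lemma LevelIrreducible.exists_stationary [Nonempty (Fin N)] (hW : W.LevelIrreducible) :
    ∃ ν, W.IsLevelStationary ν ∧ ∀ k, 0 < ν k := by
  classical
  have hinj : ¬ Function.Injective W.levelGenerator := by
    intro h
    have h1 := @h (fun _ => 1) 0 (by rw [levelGenerator_const, map_zero])
    have := congrFun h1 (Classical.arbitrary _)
    simp at this
  have hsurj : LinearMap.range W.levelGenerator < ⊤ := by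
    rw [lt_top_iff_ne_top]
    exact fun h => hinj (LinearMap.injective_iff_surjective.mpr (LinearMap.range_eq_top.mp h))
  obtain ⟨φ, hφ0, hφ⟩ := Submodule.exists_le_ker_of_lt_top _ hsurj
  set μ : Fin N → ℝ := fun k => φ (Pi.single k 1) with hμ
  have hφμ : ∀ m, φ m = ∑ k, μ k * m k := by
    intro m
    conv_lhs => rw [LinearMap.pi_apply_eq_sum_univ φ m]
    refine Finset.sum_congr rfl fun k _ => ?_
    rw [smul_eq_mul, mul_comm]
    congr 2
    ext j
    simp [Pi.single_apply, eq_comm]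
  have hμL : ∀ g, ∑ k, μ k * W.levelGenerator g k = 0 := by
    intro g
    rw [← hφμ]
    exact hφ ⟨g, rfl⟩
  obtain ⟨o, ho⟩ : ∃ o, μ o ≠ 0 := by
    by_contra! h
    exact hφ0 (LinearMap.ext fun m => by simp [hφμ, h])
  set Q : Fin N → Fin N → ℝ := fun k j => W.stepMean k (fun s => if s.2 = j then 1 else 0)
    with hQ
  have hQ0 : ∀ k j, 0 ≤ Q k j := fun k j => by
    refine Finset.sum_nonneg fun s _ => mul_nonneg (W.weight_nonneg k s) ?_
    dsimp only
    split_ifs <;> simp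
  have hQsum : ∀ k, ∑ j, Q k j = 1 := by
    intro k
    have := W.stepMean_comp_snd (fun _ => 1) k
    rw [stepMean_const] at this
    simpa using this.symm
  have hμQ : ∀ j, ∑ k, μ k * Q k j = μ j := by
    intro j
    have := hμL (Pi.single j 1)
    simp_rw [levelGenerator_apply, mul_sub, Finset.sum_sub_distrib, Pi.single_apply] at this
    simp at this
    linarith
  have habs : ∀ j, |μ j| ≤ ∑ k, |μ k| * Q k j := by
    intro j
    rw [← hμQ j]
    refine (Finset.abs_sum_le_sum_abs _ _).trans_eq (Finset.sum_congr rfl fun k _ => ?_)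
    rw [abs_mul, abs_of_nonneg (hQ0 k j)]
  have htot : ∑ j, |μ j| = ∑ j, ∑ k, |μ k| * Q k j := by
    rw [Finset.sum_comm]
    simp_rw [← Finset.mul_sum, hQsum, mul_one]
  have heq : ∀ j, |μ j| = ∑ k, |μ k| * Q k j := fun j =>
    (Finset.sum_eq_sum_iff_of_le fun j _ => habs j).mp htot j (Finset.mem_univ j)
  have hpos : ∀ k, 0 < |μ k| := by
    refine hW {k | 0 < |μ k|} ⟨o, abs_pos.mpr ho⟩ fun k hk s hs hw => ?_
    have h1 : 0 < Q k s.2 := by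
      refine lt_of_lt_of_le ?_ (Finset.single_le_sum (f := fun t : ThickLattice d N =>
        W.weight k t * (if t.2 = s.2 then 1 else 0)) (fun t _ => ?_) hs)
      · simpa using hw
      · refine mul_nonneg (W.weight_nonneg k t) ?_
        split_ifs <;> simp
    have h2 : |μ k| * Q k s.2 ≤ ∑ k, |μ k| * Q k s.2 :=
      Finset.single_le_sum (f := fun k => |μ k| * Q k s.2)
        (fun k _ => mul_nonneg (abs_nonneg _) (hQ0 _ _)) (Finset.mem_univ k)
    rw [← heq] at h2
    exact (mul_pos hk h1).trans_le h2
  have hsum : 0 < ∑ k, |μ k| := Finset.sum_pos (fun k _ => hpos k) Finset.univ_nonempty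
  refine ⟨fun k => |μ k| / ∑ k, |μ k|, ⟨?_, fun g => ?_⟩, fun k => div_pos (hpos k) hsum⟩
  · rw [← Finset.sum_div, div_self hsum.ne']
  · have h1 : ∑ k, |μ k| * W.levelGenerator g k = 0 := by
      rw [sum_mul_levelGenerator]
      exact Finset.sum_eq_zero fun j _ => by rw [← heq j, sub_self, zero_mul]
    simp_rw [div_mul_eq_mul_div, ← Finset.sum_div, h1, zero_div]

/-- Solvability of the Poisson equation for the induced chain on the levels. -/
lemma LevelIrreducible.exists_levelGenerator_eq (hW : W.LevelIrreducible) {ν : Fin N → ℝ}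
    (hν : W.IsLevelStationary ν) {m : Fin N → ℝ} (hm : ∑ k, ν k * m k = 0) :
    ∃ g, W.levelGenerator g = m := by
  obtain ⟨hν1, hν0⟩ := hν
  -- The rank-one term, the ν-mean of g times the constant 1, makes the operator injective, hence
  -- bijective. Pairing with ν shows that L g and g have the same ν-mean, so for data of mean zero
  -- the extra term vanishes on the solution.
  set L : (Fin N → ℝ) →ₗ[ℝ] (Fin N → ℝ) := W.levelGenerator +
    LinearMap.pi (fun _ => ∑ k, ν k • LinearMap.proj k) with hL
  have hLapp : ∀ g k, L g k = W.levelGenerator g k + ∑ j, ν j * g j := by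
    intro g k
    simp [hL]
  have hνL : ∀ g, ∑ k, ν k * L g k = ∑ j, ν j * g j := by
    intro g
    simp_rw [hLapp, mul_add, Finset.sum_add_distrib, hν0, ← Finset.sum_mul, hν1]
    ring
  have hLeq : ∀ g, ∑ k, ν k * L g k = 0 → W.levelGenerator g = L g := by
    intro g hg
    ext k
    rw [hLapp, ← hνL, hg, add_zero]
  have hinj : Function.Injective L := by
    rw [← LinearMap.ker_eq_bot, LinearMap.ker_eq_bot']
    intro g hg
    have h0 : ∑ k, ν k * L g k = 0 := by simp [hg]
    have h1 := hW.eq_of_levelGenerator_eq_zero ((hLeq g h0).trans hg)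
    rw [hνL] at h0
    ext k
    have h2 : ∑ j, ν j * g j = ∑ j, ν j * g k :=
      Finset.sum_congr rfl fun j _ => by rw [h1 j k]
    rw [h0, ← Finset.sum_mul, hν1, one_mul] at h2
    exact h2.symm
  obtain ⟨g, rfl⟩ := LinearMap.injective_iff_surjective.mp hinj m
  exact ⟨g, hLeq g hm⟩

/-- The indicator of j minus ν j lies in the range of the generator, so its μ-mean is zero, which
says μ j = ν j. -/
lemma LevelIrreducible.stationary_unique (hW : W.LevelIrreducible) {ν μ : Fin N → ℝ}
    (hν : W.IsLevelStationary ν) (hμ : W.IsLevelStationary μ) : μ = ν := by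
  classical
  ext j
  obtain ⟨g, hg⟩ := hW.exists_levelGenerator_eq hν
    (m := fun k => (Pi.single j 1 : Fin N → ℝ) k - ν j) (by
      simp_rw [mul_sub, Finset.sum_sub_distrib, ← Finset.sum_mul, hν.1]
      simp [Pi.single_apply])
  have := hμ.2 g
  simp_rw [hg, mul_sub, Finset.sum_sub_distrib, ← Finset.sum_mul, hμ.1] at this
  simp [Pi.single_apply] at this
  linarith

end LatticeWalk

/-! ### Taylor estimates for slowly varying functions. -/

/-- `ψ₁, ψ₂, ψ₃` are the successive derivatives of `ψ` on `[t₀, ∞)`, with the decay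
`ψ₂ = O(t⁻²)` and `ψ₃ = O(t⁻³)`. -/
structure IsSlowlyVarying (t₀ κ : ℝ) (ψ ψ₁ ψ₂ ψ₃ : ℝ → ℝ) : Prop where
  deriv : ∀ t, t₀ ≤ t → HasDerivAt ψ (ψ₁ t) t
  deriv₁ : ∀ t, t₀ ≤ t → HasDerivAt ψ₁ (ψ₂ t) t
  deriv₂ : ∀ t, t₀ ≤ t → HasDerivAt ψ₂ (ψ₃ t) t
  bound₂ : ∀ t, t₀ ≤ t → |ψ₂ t| ≤ κ / t ^ 2
  bound₃ : ∀ t, t₀ ≤ t → |ψ₃ t| ≤ κ / t ^ 3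

namespace IsSlowlyVarying

variable {t₀ κ : ℝ} {ψ ψ₁ ψ₂ ψ₃ : ℝ → ℝ}

lemma nonneg (hψ : IsSlowlyVarying t₀ κ ψ ψ₁ ψ₂ ψ₃) : 0 ≤ κ := by
  have h1 := (abs_nonneg _).trans (hψ.bound₂ (max t₀ 1) (le_max_left _ _))
  by_contra! h
  have : 0 < (max t₀ 1) ^ 2 := by positivity
  exact absurd h1 (not_le.mpr (div_neg_of_neg_of_pos h this))

/-- The mean value inequality is applied three times, to ψ₂, ψ₁ and ψ, on the interval of radius |h|
around t. There every point is at least t/2 ≥ t₀, whence the factor 8 = 2³ in the bound on ψ₃. -/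
lemma taylor (hψ : IsSlowlyVarying t₀ κ ψ ψ₁ ψ₂ ψ₃) (ht₀ : 0 < t₀) {t h : ℝ} (ht : 2 * t₀ ≤ t)
    (hh : |h| ≤ t / 2) :
    |ψ₂ (t + h) - ψ₂ t| ≤ 8 * κ / t ^ 3 * |h| ∧
    |ψ (t + h) - ψ t - ψ₁ t * h - ψ₂ t / 2 * h ^ 2| ≤ 8 * κ / t ^ 3 * |h| ^ 3 := by
  have htpos : 0 < t := by linarith
  have hκ := hψ.nonneg
  set M := 8 * κ / t ^ 3 with hM
  have hM0 : 0 ≤ M := by positivity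
  set I := Set.Icc (t - |h|) (t + |h|) with hI
  have hconv : Convex ℝ I := convex_Icc _ _
  have htI : t ∈ I := ⟨by linarith [abs_nonneg h], by linarith [abs_nonneg h]⟩
  have hthI : t + h ∈ I := ⟨by linarith [neg_abs_le h], by linarith [le_abs_self h]⟩
  have hI2 : ∀ u ∈ I, t / 2 ≤ u := fun u hu => by linarith [hu.1]
  have hI0 : ∀ u ∈ I, t₀ ≤ u := fun u hu => by linarith [hI2 u hu]
  have hIh : ∀ u ∈ I, |u - t| ≤ |h| := fun u hu => by
    rw [abs_le]; constructor <;> linarith [hu.1, hu.2]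
  have hb3 : ∀ u ∈ I, ‖ψ₃ u‖ ≤ M := fun u hu => by
    refine (hψ.bound₃ u (hI0 u hu)).trans ?_
    have h1 : t ^ 3 / 8 ≤ u ^ 3 := by
      calc t ^ 3 / 8 = (t / 2) ^ 3 := by ring
        _ ≤ u ^ 3 := pow_le_pow_left₀ (by positivity) (hI2 u hu) 3
    rw [hM, show 8 * κ / t ^ 3 = κ / (t ^ 3 / 8) by field_simp]
    exact div_le_div_of_nonneg_left hκ (by positivity) h1
  have s1 : ∀ u ∈ I, |ψ₂ u - ψ₂ t| ≤ M * |u - t| := fun u hu =>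
    hconv.norm_image_sub_le_of_norm_hasDerivWithin_le
      (fun x hx => (hψ.deriv₂ x (hI0 x hx)).hasDerivWithinAt) hb3 htI hu
  have s2 : ∀ u ∈ I, |ψ₁ u - ψ₁ t - ψ₂ t * (u - t)| ≤ M * |h| * |u - t| := fun u hu => by
    have := hconv.norm_image_sub_le_of_norm_hasDerivWithin_le
      (f := fun x => ψ₁ x - ψ₂ t * x) (f' := fun x => ψ₂ x - ψ₂ t * 1) (C := M * |h|)
      (fun x hx => ((hψ.deriv₁ x (hI0 x hx)).sub
        ((hasDerivAt_id x).const_mul _)).hasDerivWithinAt)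
      (fun x hx => by
        rw [mul_one]
        exact (s1 x hx).trans (mul_le_mul_of_nonneg_left (hIh x hx) hM0)) htI hu
    simp only [Real.norm_eq_abs] at this
    convert this using 2
    ring
  have s3 : ∀ u ∈ I, |ψ u - ψ t - ψ₁ t * (u - t) - ψ₂ t / 2 * (u - t) ^ 2|
      ≤ M * |h| * |h| * |u - t| := fun u hu => by
    have := hconv.norm_image_sub_le_of_norm_hasDerivWithin_le
      (f := fun x => ψ x - ψ₁ t * x - ψ₂ t / 2 * (x - t) ^ 2)
      (f' := fun x => ψ₁ x - ψ₁ t - ψ₂ t * (x - t)) (C := M * |h| * |h|)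
      (fun x hx => by
        have h1 := ((hψ.deriv x (hI0 x hx)).sub ((hasDerivAt_id x).const_mul (ψ₁ t))).sub
          ((((hasDerivAt_id x).sub_const t).pow 2).const_mul (ψ₂ t / 2))
        refine (h1.congr_deriv ?_).hasDerivWithinAt
        simp
        ring)
      (fun x hx => (s2 x hx).trans
        (mul_le_mul_of_nonneg_left (hIh x hx) (by positivity))) htI hu
    simp only [Real.norm_eq_abs] at this
    convert this using 2
    ring
  refine ⟨?_, ?_⟩
  · simpa using s1 _ hthI
  · have := s3 _ hthI
    simp only [add_sub_cancel_left] at this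
    refine this.trans_eq ?_
    ring

/-- One step estimate for `ψ(q) + 2 ψ₂(q) c`. -/
lemma step_estimate (hψ : IsSlowlyVarying t₀ κ ψ ψ₁ ψ₂ ψ₃) (ht₀ : 0 < t₀) {r u e v w c c' K : ℝ}
    (hr : 1 ≤ r) (hK : 1 ≤ K) (hrK : 6 * K ≤ r) (hrt : 2 * t₀ ≤ r ^ 2) (hu : |u| ≤ K * r)
    (he : |e| ≤ K) (hc : c' - c = v + w) (hw : |w| ≤ K * r) (hc' : |c'| ≤ K * r ^ 2) :
    ψ (r ^ 2 + (2 * u + e)) + 2 * ψ₂ (r ^ 2 + (2 * u + e)) * c' ≤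
      ψ (r ^ 2) + 2 * ψ₂ (r ^ 2) * c + ψ₁ (r ^ 2) * (2 * u + e) +
        2 * ψ₂ (r ^ 2) * (u ^ 2 + v) + 300 * κ * K ^ 3 / r ^ 3 := by
  have hκ := hψ.nonneg
  have hr0 : 0 < r := by linarith
  set t := r ^ 2 with ht
  set h := 2 * u + e with hh
  have hhr : |h| ≤ 3 * K * r := by
    have h1 : |h| ≤ 2 * |u| + |e| := by
      refine (abs_add_le _ _).trans ?_
      rw [abs_mul, abs_two]
    nlinarith
  -- Here 6K ≤ r is used: |h| ≤ 3Kr ≤ r²/2.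
  have hht : |h| ≤ t / 2 := by nlinarith
  obtain ⟨T1, T2⟩ := hψ.taylor ht₀ hrt hht
  have hb2 := hψ.bound₂ t (by linarith)
  have ht0 : t₀ ≤ t := by linarith
  have e2 : κ / t ^ 2 = κ / r ^ 3 / r := by rw [ht]; field_simp
  have e3 : 8 * κ / t ^ 3 = 8 * (κ / r ^ 3) / r ^ 3 := by rw [ht]; field_simp
  set ρ := κ / r ^ 3 with hρ
  have hρ0 : 0 ≤ ρ := by positivity
  rw [e2] at hb2
  rw [e3] at T1 T2
  -- Four errors are of order ρ = κ/r³: the Taylor remainder, the part of h² beyond 4u², the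
  -- variation of ψ₂ against c', and the lower-order part w of the change of c. Their constants 216,
  -- 5/2, 48 and 2 add up to less than 300.
  have A1 : |ψ (t + h) - ψ t - ψ₁ t * h - ψ₂ t / 2 * h ^ 2| ≤ 216 * K ^ 3 * ρ := by
    refine T2.trans ?_
    calc 8 * ρ / r ^ 3 * |h| ^ 3 ≤ 8 * ρ / r ^ 3 * (3 * K * r) ^ 3 := by gcongr
      _ = 216 * K ^ 3 * ρ := by field_simp; ring
  have A2 : |ψ₂ t / 2 * (4 * u * e + e ^ 2)| ≤ 5 / 2 * K ^ 2 * ρ := by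
    have h1 : |4 * u * e + e ^ 2| ≤ 5 * K ^ 2 * r := by
      calc |4 * u * e + e ^ 2| ≤ |4 * u * e| + |e ^ 2| := abs_add_le _ _
        _ = 4 * |u| * |e| + |e| ^ 2 := by simp [abs_mul]
        _ ≤ 4 * (K * r) * K + K ^ 2 := by gcongr
        _ ≤ 5 * K ^ 2 * r := by nlinarith [sq_nonneg K]
    rw [abs_mul, abs_div, abs_two]
    calc |ψ₂ t| / 2 * |4 * u * e + e ^ 2| ≤ (ρ / r) / 2 * (5 * K ^ 2 * r) := by gcongr
      _ = 5 / 2 * K ^ 2 * ρ := by field_simp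
  have A3 : |2 * (ψ₂ (t + h) - ψ₂ t) * c'| ≤ 48 * K ^ 2 * ρ := by
    rw [abs_mul, abs_mul, abs_two]
    calc 2 * |ψ₂ (t + h) - ψ₂ t| * |c'| ≤ 2 * (8 * ρ / r ^ 3 * (3 * K * r)) * (K * r ^ 2) := by
          gcongr
          exact T1.trans (by gcongr)
      _ = 48 * K ^ 2 * ρ := by field_simp; ring
  have A4 : |2 * ψ₂ t * w| ≤ 2 * K * ρ := by
    rw [abs_mul, abs_mul, abs_two]
    calc 2 * |ψ₂ t| * |w| ≤ 2 * (ρ / r) * (K * r) := by gcongr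
      _ = 2 * K * ρ := by field_simp
  have hK2 : K ^ 2 ≤ K ^ 3 := pow_le_pow_right₀ hK (by norm_num)
  have hK1 : K ≤ K ^ 3 := le_self_pow₀ hK (by norm_num)
  have B2 : K ^ 2 * ρ ≤ K ^ 3 * ρ := by gcongr
  have B1 : K * ρ ≤ K ^ 3 * ρ := by gcongr
  have B0 : 0 ≤ K ^ 3 * ρ := by positivity
  have hfin : 300 * κ * K ^ 3 / r ^ 3 = 300 * (K ^ 3 * ρ) := by rw [hρ]; ring
  have hcc : c = c' - v - w := by linarith
  have hexp : ψ (t + h) + 2 * ψ₂ (t + h) * c' =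
      ψ t + 2 * ψ₂ t * c + ψ₁ t * h + 2 * ψ₂ t * (u ^ 2 + v) +
      ((ψ (t + h) - ψ t - ψ₁ t * h - ψ₂ t / 2 * h ^ 2) + ψ₂ t / 2 * (4 * u * e + e ^ 2) +
        2 * (ψ₂ (t + h) - ψ₂ t) * c' + 2 * ψ₂ t * w) := by
    rw [hcc, hh]; ring
  rw [hexp, hfin]
  have := le_abs_self (ψ (t + h) - ψ t - ψ₁ t * h - ψ₂ t / 2 * h ^ 2)
  have := le_abs_self (ψ₂ t / 2 * (4 * u * e + e ^ 2))
  have := le_abs_self (2 * (ψ₂ (t + h) - ψ₂ t) * c')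
  have := le_abs_self (2 * ψ₂ t * w)
  linarith

end IsSlowlyVarying

/-! ### The corrected radial test function and its drift. -/

namespace LatticeWalk

variable {d N : ℕ}

/-- The squared norm of `y`, corrected by a function of the level. -/
def radial (a : Fin N → ℝ) (y : Fin d → ℝ) (k : Fin N) : ℝ := ∑ i, y i ^ 2 + a k

/-- A quadratic form in `y` depending on the level. -/
def levelForm (C : Fin N → Fin d → Fin d → ℝ) (y : Fin d → ℝ) (k : Fin N) : ℝ :=
  ∑ i, ∑ j, C k i j * (y i * y j)

/-- The function `ψ(q) + 2 ψ₂(q) c` of the corrected square norm `q` and the quadratic form `c`. -/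
def lyapunov (ψ ψ₂ : ℝ → ℝ) (a : Fin N → ℝ) (C : Fin N → Fin d → Fin d → ℝ) (y : Fin d → ℝ)
    (k : Fin N) : ℝ :=
  ψ (radial a y k) + 2 * ψ₂ (radial a y k) * levelForm C y k

lemma abs_le_sqrt_radial {a : Fin N → ℝ} (ha : ∀ k, 1 ≤ a k) (y : Fin d → ℝ) (k : Fin N)
    (i : Fin d) : |y i| ≤ √(radial a y k) := by
  refine Real.abs_le_sqrt ?_
  have := Finset.single_le_sum (f := fun i => y i ^ 2) (fun i _ => sq_nonneg _)
    (Finset.mem_univ i)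
  have := ha k
  simp only [radial]
  linarith

lemma one_le_radial {a : Fin N → ℝ} (ha : ∀ k, 1 ≤ a k) (y : Fin d → ℝ) (k : Fin N) :
    1 ≤ radial a y k := by
  have : 0 ≤ ∑ i, y i ^ 2 := Finset.sum_nonneg fun i _ => sq_nonneg _
  have := ha k
  simp only [radial]
  linarith

lemma abs_sum_le_mul {f : Fin d → ℝ} {B : ℝ} (h : ∀ i, |f i| ≤ B) : |∑ i, f i| ≤ d * B := by
  refine (Finset.abs_sum_le_sum_abs _ _).trans ?_
  refine (Finset.sum_le_sum fun i _ => h i).trans_eq ?_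
  simp

lemma abs_levelForm_le {C : Fin N → Fin d → Fin d → ℝ} {D B : ℝ} (hC : ∀ k i j, |C k i j| ≤ D)
    {y : Fin d → ℝ} (hy : ∀ i, |y i| ≤ B) (k : Fin N) :
    |levelForm C y k| ≤ d ^ 2 * D * B ^ 2 := by
  refine (abs_sum_le_mul fun i => abs_sum_le_mul (B := D * (B * B)) fun j => ?_).trans_eq (by ring)
  have hB := (abs_nonneg _).trans (hy i)
  have hD := (abs_nonneg _).trans (hC k i j)
  rw [abs_mul, abs_mul]
  gcongr
  exacts [hC k i j, hy i, hy j]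

/-- This is `step_estimate` with r = √q and u = ⟨y, δ⟩. The change of the quadratic form splits into
v, quadratic in y and due to the change of level, and w, at most linear in y. The constant K
dominates dD, dD² + D, 3d²D³ and 4d²D³, which occur in the bounds for u, e, w and c'. -/
lemma lyapunov_step {t₀ κ : ℝ} {ψ ψ₁ ψ₂ ψ₃ : ℝ → ℝ} (hψ : IsSlowlyVarying t₀ κ ψ ψ₁ ψ₂ ψ₃)
    (ht₀ : 0 < t₀) {a : Fin N → ℝ} {C : Fin N → Fin d → Fin d → ℝ} (ha : ∀ k, 1 ≤ a k)
    {D : ℝ} (hD : 1 ≤ D) (haD : ∀ k, a k ≤ D) (hCD : ∀ k i j, |C k i j| ≤ D)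
    {y δ : Fin d → ℝ} (hδ : ∀ i, |δ i| ≤ D) {k l : Fin N} {K : ℝ}
    (hK : K = 4 * (d + 1) ^ 2 * D ^ 3)
    (hrK : 6 * K ≤ √(radial a y k)) (hrt : 2 * t₀ ≤ radial a y k) :
    lyapunov ψ ψ₂ a C (y + δ) l ≤ lyapunov ψ ψ₂ a C y k +
      ψ₁ (radial a y k) * (2 * ∑ i, y i * δ i + (∑ i, δ i ^ 2 + a l - a k)) +
      2 * ψ₂ (radial a y k) * (∑ i, ∑ j, (y i * y j) * (δ i * δ j + (C l i j - C k i j))) +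
      300 * κ * K ^ 3 / √(radial a y k) ^ 3 := by
  set r := √(radial a y k) with hr
  have hq1 := one_le_radial ha y k
  have hr2 : r ^ 2 = radial a y k := Real.sq_sqrt (by linarith)
  have hr1 : 1 ≤ r := by rw [hr]; exact Real.one_le_sqrt.mpr hq1
  have hyr : ∀ i, |y i| ≤ r := abs_le_sqrt_radial ha y k
  have hd0 : (0 : ℝ) ≤ d := Nat.cast_nonneg d
  have hK1 : 1 ≤ K := by
    rw [hK]
    have h1 : (1 : ℝ) ≤ D ^ 3 := one_le_pow₀ hD
    have h2 : (1 : ℝ) ≤ (d + 1) ^ 2 := one_le_pow₀ (by linarith)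
    nlinarith
  have hDK : D ≤ D ^ 3 := le_self_pow₀ hD (by norm_num)
  have hDK2 : D ^ 2 ≤ D ^ 3 := pow_le_pow_right₀ hD (by norm_num)
  have hD0 : 0 < D ^ 3 := by positivity
  have hu : |∑ i, y i * δ i| ≤ K * r := by
    refine (abs_sum_le_mul (B := r * D) fun i => ?_).trans ?_
    · rw [abs_mul]
      gcongr
      exacts [hyr i, hδ i]
    · have : d * D ≤ K := by
        rw [hK]
        have : (d : ℝ) ≤ 4 * (d + 1) ^ 2 := by nlinarith
        exact mul_le_mul this hDK (by linarith) (by positivity)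
      rw [show (d : ℝ) * (r * D) = d * D * r by ring]
      exact mul_le_mul_of_nonneg_right this (by linarith)
  have he : |∑ i, δ i ^ 2 + a l - a k| ≤ K := by
    have h1 : |∑ i, δ i ^ 2| ≤ d * D ^ 2 := abs_sum_le_mul fun i => by
      rw [abs_pow]
      gcongr
      exact hδ i
    have h2 : |a l - a k| ≤ D := by
      rw [abs_le]
      constructor <;> linarith [ha l, ha k, haD l, haD k]
    rw [add_sub_assoc]
    refine (abs_add_le _ _).trans ((add_le_add h1 h2).trans ?_)
    rw [hK]
    calc d * D ^ 2 + D ≤ d * D ^ 3 + D ^ 3 := by gcongr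
      _ = (d + 1) * D ^ 3 := by ring
      _ ≤ 4 * (d + 1) ^ 2 * D ^ 3 := by
        gcongr
        nlinarith
  have hw : |∑ i, ∑ j, C l i j * (y i * δ j + δ i * y j + δ i * δ j)| ≤ K * r := by
    refine (abs_sum_le_mul fun i => abs_sum_le_mul (B := D * (3 * D ^ 2 * r)) fun j => ?_).trans ?_
    · rw [abs_mul]
      gcongr
      · exact hCD l i j
      · refine (abs_add_three _ _ _).trans ?_
        simp_rw [abs_mul]
        calc |y i| * |δ j| + |δ i| * |y j| + |δ i| * |δ j| ≤ r * D + D * r + D * D := by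
              gcongr
              exacts [hyr i, hδ j, hδ i, hyr j, hδ i, hδ j]
          _ ≤ 3 * D ^ 2 * r := by nlinarith [mul_nonneg (sub_nonneg.mpr hD) (sub_nonneg.mpr hr1)]
    · have : 3 * (d : ℝ) ^ 2 * D ^ 3 ≤ K := by
        rw [hK]
        gcongr <;> linarith
      rw [show (d : ℝ) * (d * (D * (3 * D ^ 2 * r))) = (3 * (d : ℝ) ^ 2 * D ^ 3) * r by ring]
      exact mul_le_mul_of_nonneg_right this (by linarith)
  have hc' : |levelForm C (y + δ) l| ≤ K * r ^ 2 := by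
    refine (abs_levelForm_le hCD (B := 2 * D * r) (fun i => ?_) l).trans ?_
    · calc |(y + δ) i| ≤ |y i| + |δ i| := abs_add_le _ _
        _ ≤ r + D := add_le_add (hyr i) (hδ i)
        _ ≤ 2 * D * r := by nlinarith [mul_nonneg (sub_nonneg.mpr hD) (sub_nonneg.mpr hr1)]
    · rw [hK]
      calc (d : ℝ) ^ 2 * D * (2 * D * r) ^ 2 = 4 * (d : ℝ) ^ 2 * D ^ 3 * r ^ 2 := by ring
        _ ≤ _ := by
          gcongr
          linarith
  have hc : levelForm C (y + δ) l - levelForm C y k =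
      ∑ i, ∑ j, (y i * y j) * (C l i j - C k i j) +
      ∑ i, ∑ j, C l i j * (y i * δ j + δ i * y j + δ i * δ j) := by
    simp only [levelForm, ← Finset.sum_add_distrib, ← Finset.sum_sub_distrib, Pi.add_apply]
    refine Finset.sum_congr rfl fun i _ => Finset.sum_congr rfl fun j _ => ?_
    ring
  have hq' : radial a (y + δ) l =
      r ^ 2 + (2 * ∑ i, y i * δ i + (∑ i, δ i ^ 2 + a l - a k)) := by
    rw [hr2]
    simp only [radial, Pi.add_apply, add_sq, Finset.sum_add_distrib, Finset.mul_sum]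
    simp only [mul_assoc]
    ring
  have hsq : (∑ i, y i * δ i) ^ 2 + ∑ i, ∑ j, (y i * y j) * (C l i j - C k i j) =
      ∑ i, ∑ j, (y i * y j) * (δ i * δ j + (C l i j - C k i j)) := by
    rw [sq, Finset.sum_mul_sum, ← Finset.sum_add_distrib]
    refine Finset.sum_congr rfl fun i _ => ?_
    rw [← Finset.sum_add_distrib]
    exact Finset.sum_congr rfl fun j _ => by ring
  have := hψ.step_estimate ht₀ hr1 hK1 hrK (hr2 ▸ hrt) hu he hc hw hc'
  rw [hsq, ← hq', hr2] at this
  exact this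

/-- Drift estimate for the corrected function `ψ(q) + 2 ψ₂(q) c` along a martingale with increments
`δ` whose averaged covariance is the identity. -/
theorem exists_lyapunov_estimate (W : LatticeWalk d N)
    {δ : Fin N → ThickLattice d N → Fin d → ℝ} {a : Fin N → ℝ} {C : Fin N → Fin d → Fin d → ℝ}
    (hδ : ∀ k i, W.stepMean k (fun s => δ k s i) = 0) (ha : ∀ k, 1 ≤ a k)
    (haδ : ∀ k, W.stepMean k (fun s => ∑ i, δ k s i ^ 2 + a s.2 - a k) = d)
    (hC : ∀ k i j, W.stepMean k (fun s => δ k s i * δ k s j + (C s.2 i j - C k i j)) =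
      if i = j then 1 else 0)
    {t₀ κ : ℝ} {ψ ψ₁ ψ₂ ψ₃ : ℝ → ℝ} (hψ : IsSlowlyVarying t₀ κ ψ ψ₁ ψ₂ ψ₃) (ht₀ : 0 < t₀) :
    ∃ K M : ℝ, ∀ k y, M ≤ radial a y k →
      W.stepMean k (fun s => lyapunov ψ ψ₂ a C (y + δ k s) s.2) ≤ lyapunov ψ ψ₂ a C y k +
        (d * ψ₁ (radial a y k) + 2 * radial a y k * ψ₂ (radial a y k)) +
        K / √(radial a y k) ^ 3 := by
  obtain ⟨D₁, hD₁⟩ := Finite.exists_le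
    (fun x : Fin N × W.steps × Fin d => |δ x.1 x.2.1 x.2.2|)
  obtain ⟨D₂, hD₂⟩ := Finite.exists_le (fun x : Fin N × Fin d × Fin d => |C x.1 x.2.1 x.2.2|)
  obtain ⟨D₃, hD₃⟩ := Finite.exists_le a
  set D := max 1 (max D₁ (max D₂ D₃)) with hDdef
  have hD : 1 ≤ D := le_max_left _ _
  have hδD : ∀ k, ∀ s ∈ W.steps, ∀ i, |δ k s i| ≤ D := fun k s hs i =>
    (hD₁ (k, ⟨s, hs⟩, i)).trans (by simp [hDdef])
  have hCD : ∀ k i j, |C k i j| ≤ D := fun k i j => (hD₂ (k, i, j)).trans (by simp [hDdef])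
  have haD : ∀ k, a k ≤ D := fun k => (hD₃ k).trans (by simp [hDdef])
  set K : ℝ := 4 * (d + 1) ^ 2 * D ^ 3 with hK
  have hκ := hψ.nonneg
  refine ⟨300 * κ * K ^ 3 + 2 * κ * D, max (2 * t₀) ((6 * K) ^ 2), fun k y hM => ?_⟩
  have hrt : 2 * t₀ ≤ radial a y k := (le_max_left _ _).trans hM
  have hrK : 6 * K ≤ √(radial a y k) := Real.le_sqrt_of_sq_le ((le_max_right _ _).trans hM)
  set q := radial a y k with hq
  have hq1 : 1 ≤ q := one_le_radial ha y k
  set r := √q with hr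
  have hr2 : r ^ 2 = q := Real.sq_sqrt (by linarith)
  have hr1 : 1 ≤ r := by rw [hr]; exact Real.one_le_sqrt.mpr hq1
  have h1 := W.stepMean_mono k (fun s hs =>
    lyapunov_step hψ ht₀ ha hD haD hCD (hδD k s hs) (l := s.2) hK hrK hrt)
  refine h1.trans ?_
  rw [← hq, ← hr]
  simp_rw [stepMean_add, stepMean_const_mul, stepMean_add, stepMean_const_mul, stepMean_const,
    stepMean_sum, stepMean_const_mul, hδ, hC, haδ]
  -- The corrector C has turned the covariance at each level into the identity, so the second-order
  -- term is 2ψ₂(q)|y|². Replacing |y|² by q costs 2ψ₂(q) a k, of order q⁻², which joins the error.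
  have h2 : ∑ i, ∑ j, y i * y j * (if i = j then (1 : ℝ) else 0) = q - a k := by
    simp [hq, radial, sq]
  rw [h2]
  have h3 : |ψ₂ q * a k| ≤ κ * D / r ^ 3 := by
    rw [abs_mul]
    have hb := hψ.bound₂ q (by linarith)
    have hak : |a k| ≤ D := by rw [abs_of_pos (by linarith [ha k])]; exact haD k
    calc |ψ₂ q| * |a k| ≤ κ / q ^ 2 * D := by gcongr
      _ = κ * D / r ^ 4 := by rw [← hr2]; ring
      _ ≤ κ * D / r ^ 3 := by
        gcongr
        norm_num
  have h4 := neg_abs_le (ψ₂ q * a k)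
  have h5 : (300 * κ * K ^ 3 + 2 * κ * D) / r ^ 3 =
      300 * κ * K ^ 3 / r ^ 3 + 2 * (κ * D / r ^ 3) := by ring
  rw [h5]
  simp only [mul_zero, Finset.sum_const_zero]
  linarith

end LatticeWalk

/-! ### Martingale coordinates and correctors in the centered case. -/

open scoped MatrixOrder in
/-- A positive definite real matrix is congruent to the identity matrix. -/
lemma Matrix.PosDef.exists_mul_mul_transpose_eq_one {n : Type*} [Fintype n] [DecidableEq n]
    {A : Matrix n n ℝ} (hA : A.PosDef) :
    ∃ T S : Matrix n n ℝ, S * T = 1 ∧ T * A * T.transpose = 1 := by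
  obtain ⟨B, hB⟩ := CStarAlgebra.nonneg_iff_eq_star_mul_self.mp hA.posSemidef.nonneg
  rw [Matrix.star_eq_conjTranspose, Matrix.conjTranspose_eq_transpose_of_trivial] at hB
  have hdet : IsUnit B.det := by
    have := hA.det_pos
    rw [hB, Matrix.det_mul] at this
    exact isUnit_iff_ne_zero.mpr (right_ne_zero_of_mul this.ne')
  have hdet' : IsUnit B.transpose.det := by rwa [Matrix.det_transpose]
  refine ⟨B.transpose⁻¹, B.transpose, Matrix.mul_nonsing_inv _ hdet', ?_⟩
  rw [hB, ← Matrix.mul_assoc, Matrix.nonsing_inv_mul _ hdet', Matrix.one_mul,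
    Matrix.transpose_nonsing_inv, Matrix.transpose_transpose, Matrix.mul_nonsing_inv _ hdet]

namespace LatticeWalk

variable {d N : ℕ} {W : LatticeWalk d N}

/-- The position of a point of the thickened lattice, corrected by a function of the level. -/
def position (g : Fin N → Fin d → ℝ) (u : ThickLattice d N) (i : Fin d) : ℝ := u.1 i + g u.2 i

/-- The increment of the corrected position in a step from level `k`. -/
def increment (g : Fin N → Fin d → ℝ) (k : Fin N) (s : ThickLattice d N) (i : Fin d) : ℝ :=
  s.1 i + (g s.2 i - g k i)

lemma position_add (g : Fin N → Fin d → ℝ) (u s : ThickLattice d N) :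
    position g (u.1 + s.1, s.2) = position g u + increment g u.2 s := by
  ext i
  simp only [position, increment, Pi.add_apply]
  push_cast
  ring

variable (W) in
/-- Only the full thickened lattice is nonempty and closed under transitions. -/
def IsIrreducible : Prop :=
  ∀ C : Set (ThickLattice d N), C.Nonempty →
    (∀ u ∈ C, ∀ s ∈ W.steps, 0 < W.weight u.2 s → (u.1 + s.1, s.2) ∈ C) → ∀ u, u ∈ C

lemma IsIrreducible.levelIrreducible (hW : W.IsIrreducible) : W.LevelIrreducible := by
  intro D ⟨o, ho⟩ hD k
  exact hW {u | u.2 ∈ D} ⟨(0, o), ho⟩ (fun u hu s hs hw => hD u.2 hu s hs hw) (0, k)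

variable (W) in
/-- The mean displacement of a step whose initial level has distribution `ν`. -/
def meanStep (ν : Fin N → ℝ) (i : Fin d) : ℝ :=
  ∑ k, ν k * W.stepMean k (fun s => (s.1 i : ℝ))

variable (W) in
/-- The covariance matrix of the increments of the corrected position. -/
def covariance (ν : Fin N → ℝ) (g : Fin N → Fin d → ℝ) : Matrix (Fin d) (Fin d) ℝ :=
  fun i j => ∑ k, ν k * W.stepMean k (fun s => increment g k s i * increment g k s j)

lemma sum_mul_covariance (ν : Fin N → ℝ) (g : Fin N → Fin d → ℝ) (x y : Fin d → ℝ) :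
    ∑ i, ∑ j, x i * y j * W.covariance ν g i j =
      ∑ k, ν k * W.stepMean k
        (fun s => (∑ i, x i * increment g k s i) * (∑ j, y j * increment g k s j)) := by
  have : ∀ k, W.stepMean k
      (fun s => (∑ i, x i * increment g k s i) * (∑ j, y j * increment g k s j)) =
      ∑ i, ∑ j, x i * y j * W.stepMean k (fun s => increment g k s i * increment g k s j) := by
    intro k
    simp_rw [← stepMean_const_mul, ← stepMean_sum, Finset.sum_mul_sum]
    congr 1
    ext s
    refine Finset.sum_congr rfl fun i _ => Finset.sum_congr rfl fun j _ => ?_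
    ring
  simp_rw [this, covariance, Finset.mul_sum]
  rw [Finset.sum_comm' (t' := Finset.univ) (s' := fun _ => Finset.univ) (by simp)]
  conv_rhs => rw [Finset.sum_comm]
  rw [Finset.sum_comm]
  refine Finset.sum_congr rfl fun i _ => ?_
  conv_rhs => rw [Finset.sum_comm]
  refine Finset.sum_congr rfl fun j _ => Finset.sum_congr rfl fun k _ => ?_
  ring

/-- If the quadratic form vanishes at x, every possible increment is orthogonal to x, so the pairing
of x with the corrected position is constant along the chain. By irreducibility it agrees at (0, o)
and (e_j, o), which forces x j = 0. -/
lemma IsIrreducible.posDef_covariance [Nonempty (Fin N)] (hW : W.IsIrreducible)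
    {ν : Fin N → ℝ} (hν : ∀ k, 0 < ν k) (g : Fin N → Fin d → ℝ) :
    (W.covariance ν g).PosDef := by
  classical
  refine Matrix.PosDef.of_dotProduct_mulVec_pos ?_ fun x hx => ?_
  · ext i j
    simp [covariance, mul_comm]
  · have h1 : star x ⬝ᵥ (W.covariance ν g).mulVec x =
        ∑ i, ∑ j, x i * x j * W.covariance ν g i j := by
      simp only [dotProduct, Matrix.mulVec, star_trivial, Finset.mul_sum]
      refine Finset.sum_congr rfl fun i _ => Finset.sum_congr rfl fun j _ => ?_
      ring
    rw [h1, sum_mul_covariance]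
    have h0 : ∀ k, 0 ≤ ν k * W.stepMean k
        (fun s => (∑ i, x i * increment g k s i) * (∑ j, x j * increment g k s j)) := fun k =>
      mul_nonneg (hν k).le (Finset.sum_nonneg fun s _ =>
        mul_nonneg (W.weight_nonneg k s) (mul_self_nonneg _))
    refine lt_of_le_of_ne (Finset.sum_nonneg fun k _ => h0 k) fun h => hx ?_
    have h2 : ∀ k, ∀ s ∈ W.steps, 0 < W.weight k s → ∑ i, x i * increment g k s i = 0 := by
      intro k s hs hw
      have h3 := (Finset.sum_eq_zero_iff_of_nonneg fun k _ => h0 k).mp h.symm k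
        (Finset.mem_univ k)
      have h4 := (mul_eq_zero.mp h3).resolve_left (hν k).ne'
      exact mul_self_eq_zero.mp
        (W.eq_zero_of_stepMean_eq_zero (fun s _ => mul_self_nonneg _) h4 hs hw)
    obtain ⟨o⟩ := ‹Nonempty (Fin N)›
    have h5 := hW {u | ∑ i, x i * position g u i = ∑ i, x i * position g (0, o) i}
      ⟨(0, o), rfl⟩ (fun u hu s hs hw => by
        simp only [Set.mem_ofPred_eq] at hu ⊢
        rw [position_add, ← hu]
        simp [mul_add, Finset.sum_add_distrib, h2 u.2 s hs hw])
    ext j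
    have h6 := h5 (Pi.single j 1, o)
    simp only [Set.mem_ofPred_eq, position, mul_add, Finset.sum_add_distrib] at h6
    simpa [Pi.single_apply] using h6

/-- In the centered case there are linear coordinates in which the corrected position is a
martingale with averaged covariance the identity. -/
lemma IsIrreducible.exists_coordinates [Nonempty (Fin N)] (hW : W.IsIrreducible)
    {ν : Fin N → ℝ} (hν : W.IsLevelStationary ν) (hν0 : ∀ k, 0 < ν k) (hc : W.meanStep ν = 0) :
    ∃ (g : Fin N → Fin d → ℝ) (T S : Matrix (Fin d) (Fin d) ℝ), S * T = 1 ∧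
      (∀ k i, W.stepMean k (fun s => (T.mulVec (increment g k s)) i) = 0) ∧
      ∀ i j, ∑ k, ν k * W.stepMean k
        (fun s => (T.mulVec (increment g k s)) i * (T.mulVec (increment g k s)) j) =
          if i = j then 1 else 0 := by
  -- Zero drift is exactly the solvability condition of this Poisson equation, whose solution
  -- cancels the mean displacement at each level.
  have h1 : ∀ i : Fin d, ∃ γ : Fin N → ℝ,
      W.levelGenerator γ = fun k => - W.stepMean k (fun s => (s.1 i : ℝ)) := by
    intro i
    refine hW.levelIrreducible.exists_levelGenerator_eq hν ?_
    have := congrFun hc i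
    simp only [meanStep, Pi.zero_apply] at this
    simp [this]
  choose γ hγ using h1
  set g : Fin N → Fin d → ℝ := fun k i => γ i k with hg
  have h2 : ∀ k i, W.stepMean k (fun s => increment g k s i) = 0 := by
    intro k i
    have := congrFun (hγ i) k
    rw [levelGenerator_apply] at this
    simp only [increment, stepMean_add, stepMean_sub, stepMean_const, hg]
    linarith
  obtain ⟨T, S, hST, hT⟩ := (hW.posDef_covariance hν0 g).exists_mul_mul_transpose_eq_one
  refine ⟨g, T, S, hST, fun k i => ?_, fun i j => ?_⟩
  · simp only [Matrix.mulVec, dotProduct, stepMean_sum, stepMean_const_mul, h2, mul_zero,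
      Finset.sum_const_zero]
  · have h3 := congrFun (congrFun hT i) j
    rw [Matrix.one_apply] at h3
    rw [← h3]
    simp only [Matrix.mulVec, dotProduct]
    rw [← sum_mul_covariance, Finset.sum_comm]
    simp only [Matrix.mul_apply, Matrix.transpose_apply, Finset.sum_mul]
    refine Finset.sum_congr rfl fun a _ => Finset.sum_congr rfl fun b _ => ?_
    ring

/-- Poisson equations for the covariance minus the identity and for its trace. Additive constants in
a are free, hence the arbitrary lower bound α, which later keeps q in the domain of ψ or makes q
dominate the coefficients of the quadratic form. -/
lemma LevelIrreducible.exists_correctors (hW : W.LevelIrreducible)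
    {ν : Fin N → ℝ} (hν : W.IsLevelStationary ν) {δ : Fin N → ThickLattice d N → Fin d → ℝ}
    (hδ : ∀ i j, ∑ k, ν k * W.stepMean k (fun s => δ k s i * δ k s j) = if i = j then 1 else 0) :
    ∃ C : Fin N → Fin d → Fin d → ℝ,
      (∀ k i j, W.stepMean k (fun s => δ k s i * δ k s j + (C s.2 i j - C k i j)) =
        if i = j then 1 else 0) ∧
      ∀ α : ℝ, ∃ a : Fin N → ℝ, (∀ k, α ≤ a k) ∧
        ∀ k, W.stepMean k (fun s => ∑ i, δ k s i ^ 2 + a s.2 - a k) = d := by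
  have h1 : ∀ i j : Fin d, ∃ γ : Fin N → ℝ, W.levelGenerator γ =
      fun k => (if i = j then 1 else 0) - W.stepMean k (fun s => δ k s i * δ k s j) := by
    intro i j
    refine hW.exists_levelGenerator_eq hν ?_
    simp_rw [mul_sub, Finset.sum_sub_distrib, hδ, ← Finset.sum_mul, hν.1]
    ring
  choose γ hγ using h1
  refine ⟨fun k i j => γ i j k, fun k i j => ?_, fun α => ?_⟩
  · have := congrFun (hγ i j) k
    rw [levelGenerator_apply] at this
    simp only [stepMean_add, stepMean_sub, stepMean_const]
    linarith
  · obtain ⟨b, hb⟩ := hW.exists_levelGenerator_eq hν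
      (m := fun k => d - W.stepMean k (fun s => ∑ i, δ k s i ^ 2)) (by
        simp_rw [mul_sub, Finset.sum_sub_distrib, ← Finset.sum_mul, hν.1, stepMean_sum,
          Finset.mul_sum]
        rw [Finset.sum_comm]
        simp_rw [sq, hδ]
        simp)
    obtain ⟨β, hβ⟩ := Finite.exists_le (fun k => - b k)
    refine ⟨fun k => b k + (α + β), fun k => by linarith [hβ k], fun k => ?_⟩
    have := congrFun hb k
    rw [levelGenerator_apply] at this
    simp only [stepMean_add, stepMean_sub, stepMean_const]
    linarith

/-- The matrix S recovers the position from y, and g is bounded, so bounded q confines x to a box of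
integer points. -/
lemma finite_radial_le {a : Fin N → ℝ} (ha : ∀ k, 1 ≤ a k) {g : Fin N → Fin d → ℝ}
    {T S : Matrix (Fin d) (Fin d) ℝ} (hST : S * T = 1) (R : ℝ) :
    {u : ThickLattice d N | radial a (T.mulVec (position g u)) u.2 ≤ R}.Finite := by
  obtain ⟨G, hG⟩ := Finite.exists_le (fun x : Fin N × Fin d => |g x.1 x.2|)
  obtain ⟨D, hD⟩ := Finite.exists_le (fun x : Fin d × Fin d => |S x.1 x.2|)
  set B : ℝ := d * (D * √R) + G with hB
  refine ((Set.finite_Icc (fun _ : Fin d => -⌈B⌉) (fun _ => ⌈B⌉)).prod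
    (Set.finite_univ (α := Fin N))).subset fun u hu => ?_
  have h1 : ∀ i, |(u.1 i : ℝ)| ≤ B := by
    intro i
    set y := T.mulVec (position g u) with hy
    have h2 : position g u = S.mulVec y := by
      rw [hy, Matrix.mulVec_mulVec, hST, Matrix.one_mulVec]
    have h3 : |position g u i| ≤ d * (D * √R) := by
      rw [h2]
      refine abs_sum_le_mul fun j => ?_
      rw [abs_mul]
      have := (abs_nonneg _).trans (hD (i, j))
      gcongr
      · exact hD (i, j)
      · exact (abs_le_sqrt_radial ha y u.2 j).trans (Real.sqrt_le_sqrt hu)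
    have h4 : (u.1 i : ℝ) = position g u i - g u.2 i := by simp [position]
    rw [h4]
    exact (abs_sub _ _).trans (add_le_add h3 (hG (u.2, i)))
  refine ⟨⟨fun i => ?_, fun i => ?_⟩, trivial⟩
  · have := (neg_le_neg (Int.le_ceil B)).trans (abs_le.mp (h1 i)).1
    exact_mod_cast this
  · have := (abs_le.mp (h1 i)).2.trans (Int.le_ceil B)
    exact_mod_cast this

end LatticeWalk

/-! ### The two radial profiles: log log t and t^(-1/4). -/

lemma isSlowlyVarying_log_log : IsSlowlyVarying (Real.exp 1) 7
    (fun t => Real.log (Real.log t)) (fun t => (t * Real.log t)⁻¹)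
    (fun t => -(Real.log t + 1) / (t ^ 2 * Real.log t ^ 2))
    (fun t => (2 * Real.log t ^ 2 + 3 * Real.log t + 2) / (t ^ 3 * Real.log t ^ 3)) := by
  have hL : ∀ t, Real.exp 1 ≤ t → 0 < t ∧ 1 ≤ Real.log t := fun t ht => by
    have h0 : 0 < t := (Real.exp_pos 1).trans_le ht
    exact ⟨h0, (Real.le_log_iff_exp_le h0).mpr ht⟩
  constructor
  · intro t ht
    obtain ⟨h0, h1⟩ := hL t ht
    have := (Real.hasDerivAt_log h0.ne').log (by linarith)
    refine this.congr_deriv ?_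
    field_simp
  · intro t ht
    obtain ⟨h0, h1⟩ := hL t ht
    have hl : Real.log t ≠ 0 := by linarith
    have := ((hasDerivAt_id t).mul (Real.hasDerivAt_log h0.ne')).inv (mul_ne_zero h0.ne' hl)
    refine this.congr_deriv ?_
    simp only [id]
    field_simp
    simp only [Pi.mul_apply, id]
    ring
  · intro t ht
    obtain ⟨h0, h1⟩ := hL t ht
    have hl : Real.log t ≠ 0 := by linarith
    have := (((Real.hasDerivAt_log h0.ne').add_const 1).neg).div
      (((hasDerivAt_id t).pow 2).mul ((Real.hasDerivAt_log h0.ne').pow 2))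
      (mul_ne_zero (pow_ne_zero 2 h0.ne') (pow_ne_zero 2 hl))
    refine this.congr_deriv ?_
    simp
    field_simp
    ring
  · intro t ht
    obtain ⟨h0, h1⟩ := hL t ht
    rw [abs_div, abs_neg, abs_of_pos (by linarith), abs_of_pos (by positivity),
      div_le_div_iff₀ (by positivity) (by positivity)]
    have : Real.log t + 1 ≤ 7 * Real.log t ^ 2 := by nlinarith
    nlinarith [mul_le_mul_of_nonneg_left this (sq_nonneg t)]
  · intro t ht
    obtain ⟨h0, h1⟩ := hL t ht
    rw [abs_of_pos (by positivity), div_le_div_iff₀ (by positivity) (by positivity)]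
    have h2 : Real.log t ≤ Real.log t ^ 3 := le_self_pow₀ h1 (by norm_num)
    have h3 : Real.log t ^ 2 ≤ Real.log t ^ 3 := pow_le_pow_right₀ h1 (by norm_num)
    have : 2 * Real.log t ^ 2 + 3 * Real.log t + 2 ≤ 7 * Real.log t ^ 3 := by linarith
    have h4 : 0 ≤ t ^ 3 := by positivity
    nlinarith [mul_le_mul_of_nonneg_left this h4]

lemma isSlowlyVarying_rpow : IsSlowlyVarying 1 1
    (fun t => t ^ (-(1 / 4) : ℝ)) (fun t => -(1 / 4) * t ^ (-(5 / 4) : ℝ))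
    (fun t => 5 / 16 * t ^ (-(9 / 4) : ℝ)) (fun t => -(45 / 64) * t ^ (-(13 / 4) : ℝ)) := by
  have hle : ∀ (t : ℝ) (n : ℕ) (r : ℝ), 1 ≤ t → r ≤ -n → t ^ r ≤ 1 / t ^ n := by
    intro t n r ht hr
    rw [one_div, ← Real.rpow_natCast, ← Real.rpow_neg (by linarith)]
    exact Real.rpow_le_rpow_of_exponent_le ht hr
  constructor
  · intro t ht
    refine (Real.hasDerivAt_rpow_const (Or.inl (by linarith))).congr_deriv ?_
    norm_num
  · intro t ht
    refine ((Real.hasDerivAt_rpow_const (Or.inl (by linarith))).const_mul _).congr_deriv ?_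
    norm_num
    ring
  · intro t ht
    refine ((Real.hasDerivAt_rpow_const (Or.inl (by linarith))).const_mul _).congr_deriv ?_
    norm_num
    ring
  · intro t ht
    have h0 : 0 < t ^ (-(9 / 4) : ℝ) := Real.rpow_pos_of_pos (by linarith) _
    have := hle t 2 (-(9 / 4)) ht (by norm_num)
    rw [abs_of_pos (by positivity)]
    linarith
  · intro t ht
    have h0 : 0 < t ^ (-(13 / 4) : ℝ) := Real.rpow_pos_of_pos (by linarith) _
    have := hle t 3 (-(13 / 4)) ht (by norm_num)
    rw [abs_mul, abs_of_pos h0, abs_neg, abs_of_pos (by norm_num)]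
    linarith

/-- For d = 2 the main term of log t vanishes identically and could not absorb the error. That of
log log t is -2/(t log² t), which beats t^(-3/2); smaller d only lowers it. -/
lemma eventually_drift_log_log {d : ℕ} (hd : d ≤ 2) (K : ℝ) : ∃ M : ℝ, ∀ t, M ≤ t →
    d * (t * Real.log t)⁻¹ + 2 * t * (-(Real.log t + 1) / (t ^ 2 * Real.log t ^ 2)) +
      K / √t ^ 3 < 0 := by
  -- This is used at r = √t, where log r is half of log t; the 4 compensates the square of that
  -- half.
  have h1 : ∀ᶠ r : ℝ in Filter.atTop, ‖Real.log r ^ 2‖ ≤ (4 * (|K| + 1))⁻¹ * ‖r‖ :=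
    (Real.isLittleO_pow_log_id_atTop (n := 2)).def (by positivity)
  have h2 := Real.tendsto_sqrt_atTop.eventually h1
  obtain ⟨M, hM⟩ := Filter.eventually_atTop.mp h2
  refine ⟨max M (Real.exp 1), fun t ht => ?_⟩
  have hte : Real.exp 1 ≤ t := (le_max_right _ _).trans ht
  have h0 : 0 < t := (Real.exp_pos 1).trans_le hte
  have hL : 1 ≤ Real.log t := (Real.le_log_iff_exp_le h0).mpr hte
  have h3 := hM t ((le_max_left _ _).trans ht)
  have hr : 0 < √t := Real.sqrt_pos.mpr h0
  have hrt : √t ^ 2 = t := Real.sq_sqrt h0.le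
  rw [Real.log_sqrt h0.le, Real.norm_of_nonneg (by positivity), Real.norm_of_nonneg hr.le] at h3
  set r := √t
  set l := Real.log t
  have h4 : (|K| + 1) * l ^ 2 ≤ r := by
    have := mul_le_mul_of_nonneg_left h3 (show 0 ≤ 4 * (|K| + 1) by positivity)
    rw [← mul_assoc, mul_inv_cancel₀ (by positivity), one_mul] at this
    linarith
  have hd' : (d : ℝ) ≤ 2 := by exact_mod_cast hd
  have h5 : d * (t * l)⁻¹ ≤ 2 * (t * l)⁻¹ := by gcongr
  have h6 : K / r ^ 3 < 2 / (t * l ^ 2) := by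
    rw [div_lt_div_iff₀ (by positivity) (by positivity), ← hrt]
    have : K * l ^ 2 < 2 * r := by nlinarith [le_abs_self K, sq_nonneg l, abs_nonneg K]
    nlinarith [mul_lt_mul_of_pos_left this (show 0 < r ^ 2 by positivity)]
  have h7 : 2 * (t * l)⁻¹ + 2 * t * (-(l + 1) / (t ^ 2 * l ^ 2)) = -(2 / (t * l ^ 2)) := by
    field_simp
    ring
  linarith

/-- For t^(-s) the main term is -s(d - 2 - 2s) t^(-s-1). It is negative for all d ≥ 3 and beats
t^(-3/2) as soon as 0 < s < 1/2; here s = 1/4, and the coefficient is at most -1/8. -/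
lemma eventually_drift_rpow {d : ℕ} (hd : 3 ≤ d) (K : ℝ) : ∃ M : ℝ, ∀ t, M ≤ t →
    d * (-(1 / 4) * t ^ (-(5 / 4) : ℝ)) + 2 * t * (5 / 16 * t ^ (-(9 / 4) : ℝ)) +
      K / √t ^ 3 < 0 := by
  have h1 := (tendsto_rpow_atTop (y := 1 / 4) (by norm_num)).eventually_gt_atTop (8 * K)
  obtain ⟨M, hM⟩ := Filter.eventually_atTop.mp h1
  refine ⟨max M 1, fun t ht => ?_⟩
  have ht1 : 1 ≤ t := (le_max_right _ _).trans ht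
  have h0 : 0 < t := by linarith
  have h3 := hM t ((le_max_left _ _).trans ht)
  have hd' : (3 : ℝ) ≤ d := by exact_mod_cast hd
  have e1 : t * t ^ (-(9 / 4) : ℝ) = t ^ (-(5 / 4) : ℝ) := by
    conv_lhs => rw [← Real.rpow_one t, ← Real.rpow_mul h0.le, ← Real.rpow_add h0]
    norm_num
  have e2 : 1 / √t ^ 3 = t ^ (-(3 / 2) : ℝ) := by
    rw [Real.sqrt_eq_rpow, ← Real.rpow_natCast, ← Real.rpow_mul h0.le, one_div,
      ← Real.rpow_neg h0.le]
    norm_num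
  have e3 : t ^ (-(5 / 4) : ℝ) = t ^ (1 / 4 : ℝ) * t ^ (-(3 / 2) : ℝ) := by
    rw [← Real.rpow_add h0]
    norm_num
  have p1 : 0 < t ^ (-(3 / 2) : ℝ) := Real.rpow_pos_of_pos h0 _
  have p2 : 0 < t ^ (-(5 / 4) : ℝ) := Real.rpow_pos_of_pos h0 _
  have e4 : K / √t ^ 3 < 1 / 8 * t ^ (-(5 / 4) : ℝ) := by
    rw [div_eq_mul_one_div, e2, e3]
    nlinarith [mul_lt_mul_of_pos_right h3 p1]
  have e5 : 2 * t * (5 / 16 * t ^ (-(9 / 4) : ℝ)) = 5 / 8 * t ^ (-(5 / 4) : ℝ) := by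
    rw [← e1]; ring
  rw [e5]
  nlinarith

/-! ### From the kernel to its transition data. -/

namespace LatticeWalk

variable {d N : ℕ}

/-- The transition data of an invariant finitely supported kernel. -/
noncomputable def ofKernel (p : ThickLattice d N → PMF (ThickLattice d N))
    (hfin : Chain.FinitelySupported p) : LatticeWalk d N where
  steps := Finset.univ.biUnion fun k => (hfin (0, k)).toFinset
  weight k s := (p (0, k) s).toReal
  weight_nonneg _ _ := ENNReal.toReal_nonneg
  sum_weight k := Chain.sum_toReal_eq_one fun s hs => by
    simp only [Finset.coe_biUnion, Set.mem_iUnion]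
    exact ⟨k, by simp, by simpa using hs⟩

variable {p : ThickLattice d N → PMF (ThickLattice d N)} {hfin : Chain.FinitelySupported p}

lemma mem_steps_ofKernel {k : Fin N} {s : ThickLattice d N} (h : p (0, k) s ≠ 0) :
    s ∈ (ofKernel p hfin).steps := by
  simp only [ofKernel, Finset.mem_biUnion]
  exact ⟨k, by simp, by simpa using h⟩

lemma tsum_mul_eq_stepMean (k : Fin N) (F : ThickLattice d N → ℝ) :
    ∑' s, (p (0, k) s).toReal * F s = (ofKernel p hfin).stepMean k F := by
  refine tsum_eq_sum fun s hs => ?_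
  have : p (0, k) s = 0 := by
    by_contra h
    exact hs (mem_steps_ofKernel h)
  simp [this]

lemma kernel_apply_add (hinv : ThickLattice.Invariant p) (u s : ThickLattice d N) :
    p u (u.1 + s.1, s.2) = p (0, u.2) s := by
  have := hinv u.1 0 s.1 u.2 s.2
  rwa [add_zero] at this

lemma mean_eq_stepMean (hinv : ThickLattice.Invariant p) (f : ThickLattice d N → ℝ)
    (u : ThickLattice d N) :
    Chain.mean p f u = (ofKernel p hfin).stepMean u.2 (fun s => f (u.1 + s.1, s.2)) := by
  rw [← tsum_mul_eq_stepMean, Chain.mean,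
    ← ((Equiv.addLeft u.1).prodCongr (Equiv.refl (Fin N))).tsum_eq]
  refine tsum_congr fun s => ?_
  have : (Equiv.prodCongr (Equiv.addLeft u.1) (Equiv.refl (Fin N))) s = (u.1 + s.1, s.2) := rfl
  rw [this, kernel_apply_add hinv]

lemma isIrreducible_ofKernel (hirr : Chain.Irreducible p) (hinv : ThickLattice.Invariant p) :
    (ofKernel p hfin).IsIrreducible := by
  rintro C ⟨o, ho⟩ hC u
  obtain ⟨n, hn⟩ := hirr o u
  refine Chain.mem_of_nStep_pos (fun u hu v hv => ?_) ho hn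
  have hs : p u v = p (0, u.2) (v.1 - u.1, v.2) := by
    rw [← kernel_apply_add hinv u (v.1 - u.1, v.2)]
    simp
  rw [hs] at hv
  have := hC u hu (v.1 - u.1, v.2) (mem_steps_ofKernel hv.ne')
    (ENNReal.toReal_pos hv.ne' ((p _).apply_ne_top _))
  simpa using this

lemma toReal_levelChain (k j : Fin N) :
    (ThickLattice.levelChain p k j).toReal =
      (ofKernel p hfin).stepMean k (fun s => if s.2 = j then 1 else 0) := by
  rw [ThickLattice.levelChain, PMF.map_apply, ← tsum_mul_eq_stepMean, ENNReal.tsum_toReal_eq]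
  · refine tsum_congr fun s => ?_
    by_cases h : s.2 = j
    · simp [h]
    · simp [h, Ne.symm h]
  · intro s
    split_ifs
    · exact (p (0, k)).apply_ne_top s
    · simp

lemma isStationary_levelChain_iff (ν : PMF (Fin N)) :
    Chain.IsStationary (ThickLattice.levelChain p) ν ↔
      (ofKernel p hfin).IsLevelStationary (fun k => (ν k).toReal) := by
  have h1 : ∑ k, (ν k).toReal = 1 := by
    rw [← ENNReal.toReal_sum fun k _ => ν.apply_ne_top k, ← tsum_fintype (L := .unconditional _),
      ν.tsum_coe, ENNReal.toReal_one]
  have h2 : Chain.IsStationary (ThickLattice.levelChain p) ν ↔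
      ∀ j, ∑ k, (ν k).toReal *
        (ofKernel p hfin).stepMean k (fun s => if s.2 = j then 1 else 0) = (ν j).toReal := by
    rw [Chain.IsStationary, PMF.ext_iff]
    refine forall_congr' fun j => ?_
    rw [← ENNReal.toReal_eq_toReal_iff' (PMF.apply_ne_top _ _) (PMF.apply_ne_top _ _),
      PMF.bind_apply, tsum_fintype, ENNReal.toReal_sum fun k _ =>
        ENNReal.mul_ne_top (ν.apply_ne_top k) (PMF.apply_ne_top _ _)]
    simp_rw [ENNReal.toReal_mul, toReal_levelChain (hfin := hfin)]
  rw [h2]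
  refine ⟨fun h => ⟨h1, fun g => ?_⟩, fun h j => ?_⟩
  · rw [sum_mul_levelGenerator]
    simp [h]
  · have := h.2 (Pi.single j 1)
    rw [sum_mul_levelGenerator] at this
    simp [Pi.single_apply] at this
    linarith

lemma drift_eq_meanStep (ν : PMF (Fin N)) :
    ThickLattice.drift p ν = (ofKernel p hfin).meanStep (fun k => (ν k).toReal) := by
  classical
  set W := ofKernel p hfin with hW
  have hzero : ∀ k, ∀ s ∉ W.steps, (p (0, k) s).toReal = 0 := by
    intro k s hs
    by_contra h
    exact hs (mem_steps_ofKernel (k := k) fun h0 => h (by simp [h0]))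
  ext i
  rw [ThickLattice.drift, tsum_eq_sum (s := W.steps.image Prod.fst)]
  · simp only [Finset.sum_apply, Pi.smul_apply, smul_eq_mul, meanStep]
    rw [Finset.sum_comm]
    refine Finset.sum_congr rfl fun k _ => ?_
    rw [← Finset.sum_product', stepMean, Finset.mul_sum]
    symm
    refine (Finset.sum_subset (fun s hs => ?_) fun s _ hs => ?_).trans
      (Finset.sum_congr rfl fun s _ => ?_)
    · simp only [Finset.mem_product, Finset.mem_univ, and_true]
      exact Finset.mem_image_of_mem _ hs
    · have := hzero k s hs
      simp [hW, ofKernel, this]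
    · simp only [hW, ofKernel]
      ring
  · intro x hx
    refine Finset.sum_eq_zero fun k _ => Finset.sum_eq_zero fun j _ => ?_
    rw [hzero k (x, j) fun h => hx (Finset.mem_image_of_mem Prod.fst h)]
    simp

/-! ### The non-centered case. -/

lemma exists_neg_of_hasDerivAt {ι : Type*} [Finite ι] {F : ι → ℝ → ℝ} {η : ℝ} (hη : η < 0)
    (hF : ∀ k, HasDerivAt (F k) η 0) (hF0 : ∀ k, F k 0 = 0) :
    ∀ᶠ ε in nhdsWithin (0 : ℝ) (Set.Ioi 0), ∀ k, F k ε < 0 := by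
  rw [Filter.eventually_all]
  intro k
  have h1 := (hasDerivAt_iff_tendsto_slope.mp (hF k)).eventually (gt_mem_nhds hη)
  have h2 : nhdsWithin (0 : ℝ) (Set.Ioi 0) ≤ nhdsWithin 0 {0}ᶜ :=
    nhdsWithin_mono _ fun x hx => ne_of_gt hx
  filter_upwards [h2 h1, self_mem_nhdsWithin] with ε hε hε0
  rw [slope_def_field, hF0, sub_zero, sub_zero, div_neg_iff] at hε
  rcases hε with h | h
  · exact absurd h.2 (not_lt.mpr (le_of_lt hε0))
  · exact h.1

/-- A chain with non-zero drift is transient. -/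
theorem transient_of_meanStep_ne_zero [Nonempty (Fin N)] (hirr : Chain.Irreducible p)
    (hinv : ThickLattice.Invariant p) {ν : Fin N → ℝ}
    (hν : (ofKernel p hfin).IsLevelStationary ν) (h : (ofKernel p hfin).meanStep ν ≠ 0) :
    Chain.Transient p := by
  set W := ofKernel p hfin with hW
  have hWirr : W.IsIrreducible := isIrreducible_ofKernel hirr hinv
  -- The sign makes the test function decay in the direction of the drift; the ν-mean η of the
  -- increments of ℓ is minus the squared norm of the drift.
  set ℓ : (Fin d → ℤ) → ℝ := fun x => ∑ i, -W.meanStep ν i * x i with hℓ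
  have hℓadd : ∀ x z, ℓ (x + z) = ℓ x + ℓ z := by
    intro x z
    simp only [hℓ, Pi.add_apply, Int.cast_add, mul_add, Finset.sum_add_distrib]
  set m : Fin N → ℝ := fun k => W.stepMean k (fun s => ℓ s.1) with hm
  set η := ∑ k, ν k * m k with hη
  have hη0 : η < 0 := by
    have h1 : η = - ∑ i, W.meanStep ν i ^ 2 := by
      simp only [hη, hm, hℓ, stepMean_sum, stepMean_const_mul, Finset.mul_sum]
      rw [Finset.sum_comm, ← Finset.sum_neg_distrib]
      refine Finset.sum_congr rfl fun i _ => ?_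
      rw [sq]
      conv_rhs => rw [← neg_mul]; arg 2; rw [meanStep]
      rw [Finset.mul_sum]
      exact Finset.sum_congr rfl fun k _ => by ring
    obtain ⟨i, hi⟩ := Function.ne_iff.mp h
    have h2 : 0 < ∑ i, W.meanStep ν i ^ 2 :=
      Finset.sum_pos' (fun i _ => sq_nonneg _) ⟨i, Finset.mem_univ i, by
        have : W.meanStep ν i ≠ 0 := hi
        positivity⟩
    linarith
  -- With this g the mean increment of ℓ + g is η at every level. It is the first-order coefficient
  -- in ε of the change of exp(ε ℓ)(1 + ε g), relative to exp(ε ℓ) at the starting point.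
  obtain ⟨g, hg⟩ := hWirr.levelIrreducible.exists_levelGenerator_eq hν (m := fun k => η - m k) (by
    simp_rw [mul_sub, Finset.sum_sub_distrib, ← Finset.sum_mul, hν.1]
    rw [one_mul, sub_self])
  have hderiv : ∀ k, HasDerivAt (fun ε => W.stepMean k
      (fun s => Real.exp (ε * ℓ s.1) * (1 + ε * g s.2)) - (1 + ε * g k)) η 0 := by
    intro k
    have hlin : ∀ c : ℝ, HasDerivAt (fun ε : ℝ => 1 + ε * c) c 0 := fun c => by
      simpa using ((hasDerivAt_id (0 : ℝ)).mul_const c).const_add 1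
    have hexp : ∀ c : ℝ, HasDerivAt (fun ε : ℝ => Real.exp (ε * c)) c 0 := fun c => by
      simpa using ((hasDerivAt_id (0 : ℝ)).mul_const c).exp
    have h1 : HasDerivAt (fun ε => W.stepMean k
        (fun s => Real.exp (ε * ℓ s.1) * (1 + ε * g s.2)))
        (W.stepMean k (fun s => ℓ s.1 + g s.2)) 0 := by
      refine HasDerivAt.fun_sum fun s _ => ?_
      refine (((hexp (ℓ s.1)).mul (hlin (g s.2))).const_mul _).congr_deriv ?_
      simp
    refine (h1.sub (hlin (g k))).congr_deriv ?_
    have := congrFun hg k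
    rw [levelGenerator_apply] at this
    rw [stepMean_add]
    linarith
  have hev := exists_neg_of_hasDerivAt hη0 hderiv (fun k => by simp [stepMean_const])
  have hpos : ∀ᶠ ε in nhdsWithin (0 : ℝ) (Set.Ioi 0), ∀ k, 0 < 1 + ε * g k := by
    rw [Filter.eventually_all]
    intro k
    have hcont : Continuous fun ε : ℝ => 1 + ε * g k := by fun_prop
    exact nhdsWithin_le_nhds (hcont.continuousAt.eventually (lt_mem_nhds (by simp)))
  obtain ⟨ε, hε1, hε2⟩ := (hev.and hpos).exists
  obtain ⟨o⟩ := ‹Nonempty (Fin N)›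
  -- The function is strictly superharmonic everywhere, so m only has to exceed its value at (0, o).
  refine hirr.transient_of_superharmonic hfin
    (f := fun u => Real.exp (ε * ℓ u.1) * (1 + ε * g u.2)) (b := 0)
    (m := Real.exp (ε * ℓ 0) * (1 + ε * g o) + 1)
    (fun v => mul_nonneg (Real.exp_pos _).le (hε2 v.2).le) (fun u _ => ?_) (u := (0, o)) (by simp)
  rw [mean_eq_stepMean hinv (hfin := hfin), ← hW]
  simp_rw [hℓadd, mul_add ε, Real.exp_add, mul_assoc, stepMean_const_mul]
  exact mul_lt_mul_of_pos_left (by linarith [hε1 u.2]) (Real.exp_pos _)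

/-! ### The centered case. -/

lemma mean_lyapunov (hinv : ThickLattice.Invariant p) (ψ ψ₂ : ℝ → ℝ) (a : Fin N → ℝ)
    (C : Fin N → Fin d → Fin d → ℝ) (g : Fin N → Fin d → ℝ) (T : Matrix (Fin d) (Fin d) ℝ)
    (u : ThickLattice d N) :
    Chain.mean p (fun v => lyapunov ψ ψ₂ a C (T.mulVec (position g v)) v.2) u =
      (ofKernel p hfin).stepMean u.2 (fun s =>
        lyapunov ψ ψ₂ a C (T.mulVec (position g u) + T.mulVec (increment g u.2 s)) s.2) := by
  rw [mean_eq_stepMean hinv (hfin := hfin)]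
  simp_rw [position_add, Matrix.mulVec_add]

/-- A centered chain in dimension at most two is not transient. -/
theorem not_transient_of_meanStep_eq_zero [Nonempty (Fin N)] (hirr : Chain.Irreducible p)
    (hinv : ThickLattice.Invariant p) {ν : Fin N → ℝ}
    (hν : (ofKernel p hfin).IsLevelStationary ν) (hν0 : ∀ k, 0 < ν k)
    (h : (ofKernel p hfin).meanStep ν = 0) (hd : d ≤ 2) : ¬ Chain.Transient p := by
  have hWirr : (ofKernel p hfin).IsIrreducible := isIrreducible_ofKernel hirr hinv
  obtain ⟨g, T, S, hST, hδ, hcov⟩ := hWirr.exists_coordinates hν hν0 h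
  obtain ⟨C, hC, hCa⟩ := hWirr.levelIrreducible.exists_correctors hν hcov
  -- This keeps q in [e, ∞), where the estimates for log log hold at every point.
  obtain ⟨a, ha3, haδ⟩ := hCa (Real.exp 1)
  have hexp : 1 ≤ Real.exp 1 := Real.one_le_exp zero_le_one
  have ha : ∀ k, 1 ≤ a k := fun k => hexp.trans (ha3 k)
  have hψ := isSlowlyVarying_log_log
  obtain ⟨K, M, hM⟩ := exists_lyapunov_estimate (ofKernel p hfin) hδ ha haδ hC hψ (Real.exp_pos 1)
  obtain ⟨M', hM'⟩ := eventually_drift_log_log hd K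
  obtain ⟨D, hD⟩ := Finite.exists_le (fun x : Fin N × Fin d × Fin d => |C x.1 x.2.1 x.2.2|)
  have hq : ∀ u : ThickLattice d N, Real.exp 1 ≤ radial a (T.mulVec (position g u)) u.2 := by
    intro u
    have : 0 ≤ ∑ i, T.mulVec (position g u) i ^ 2 := Finset.sum_nonneg fun i _ => sq_nonneg _
    have := ha3 u.2
    simp only [radial]
    linarith
  refine hfin.not_transient_of_lyapunov
    (f := fun v => lyapunov (fun t => Real.log (Real.log t))
      (fun t => -(Real.log t + 1) / (t ^ 2 * Real.log t ^ 2)) a C (T.mulVec (position g v)) v.2)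
    (fun c => ?_) (finite_radial_le ha hST (g := g) (max M M')) fun u hu => ?_
  -- The correction 2ψ₂(q)c is bounded: |ψ₂| ≤ 7/q² and |c| ≤ d²|D| q, so it is at most 14 d²|D|. A
  -- bound on the test function thus bounds log log q.
  · refine (finite_radial_le ha hST (g := g)
      (Real.exp (Real.exp (c + 14 * (d ^ 2 * |D|))))).subset fun u hu => ?_
    simp only [Set.mem_ofPred_eq, lyapunov] at hu ⊢
    set y := T.mulVec (position g u)
    have hform := abs_levelForm_le (fun k i j => (hD (k, i, j)).trans (le_abs_self D))
      (abs_le_sqrt_radial ha y u.2) u.2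
    have hb := hψ.bound₂ _ (hq u)
    have hqu := hq u
    set q := radial a y u.2
    have hq0 : 0 < q := (Real.exp_pos 1).trans_le hqu
    have hq1 : 1 ≤ q := hexp.trans hqu
    rw [Real.sq_sqrt hq0.le] at hform
    have hprod : |2 * (-(Real.log q + 1) / (q ^ 2 * Real.log q ^ 2)) * levelForm C y u.2| ≤
        14 * (d ^ 2 * |D|) := by
      rw [abs_mul, abs_mul, abs_two]
      calc _ ≤ 2 * (7 / q ^ 2) * (d ^ 2 * |D| * q) := by gcongr
        _ = 14 * (d ^ 2 * |D|) / q := by field_simp; ring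
        _ ≤ _ := div_le_self (by positivity) hq1
    have hlog : Real.log (Real.log q) ≤ c + 14 * (d ^ 2 * |D|) := by
      have := neg_abs_le (2 * (-(Real.log q + 1) / (q ^ 2 * Real.log q ^ 2)) * levelForm C y u.2)
      linarith
    have hlq : 0 < Real.log q := zero_lt_one.trans_le ((Real.le_log_iff_exp_le hq0).mpr hqu)
    rwa [← Real.log_le_iff_le_exp hq0, ← Real.log_le_iff_le_exp hlq]
  · simp only [Set.mem_ofPred_eq, not_le] at hu
    rw [mean_lyapunov hinv (hfin := hfin)]
    have h1 := hM u.2 _ ((le_max_left _ _).trans hu.le)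
    have h2 := hM' _ ((le_max_right _ _).trans hu.le)
    linarith

/-- A centered chain in dimension at least three is transient. -/
theorem transient_of_meanStep_eq_zero [Nonempty (Fin N)] (hirr : Chain.Irreducible p)
    (hinv : ThickLattice.Invariant p) {ν : Fin N → ℝ}
    (hν : (ofKernel p hfin).IsLevelStationary ν) (hν0 : ∀ k, 0 < ν k)
    (h : (ofKernel p hfin).meanStep ν = 0) (hd : 3 ≤ d) : Chain.Transient p := by
  have hWirr : (ofKernel p hfin).IsIrreducible := isIrreducible_ofKernel hirr hinv
  obtain ⟨g, T, S, hST, hδ, hcov⟩ := hWirr.exists_coordinates hν hν0 h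
  obtain ⟨C, hC, hCa⟩ := hWirr.levelIrreducible.exists_correctors hν hcov
  obtain ⟨D, hD⟩ := Finite.exists_le (fun x : Fin N × Fin d × Fin d => |C x.1 x.2.1 x.2.2|)
  -- This gives d²|D| ≤ q, so the correction is at most 5/8 of the main term q^(-1/4), and f lies
  -- between 3/8 and 13/8 of it.
  obtain ⟨a, haα, haδ⟩ := hCa (max 1 (d ^ 2 * |D|))
  have ha : ∀ k, 1 ≤ a k := fun k => (le_max_left _ _).trans (haα k)
  obtain ⟨K, M, hM⟩ := exists_lyapunov_estimate (ofKernel p hfin) hδ ha haδ hC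
    isSlowlyVarying_rpow one_pos
  obtain ⟨M', hM'⟩ := eventually_drift_rpow hd K
  set f : ThickLattice d N → ℝ := fun v => lyapunov (fun t => t ^ (-(1 / 4) : ℝ))
    (fun t => 5 / 16 * t ^ (-(9 / 4) : ℝ)) a C (T.mulVec (position g v)) v.2 with hf
  set q : ThickLattice d N → ℝ := fun u => radial a (T.mulVec (position g u)) u.2 with hq
  have hq1 : ∀ u, 1 ≤ q u := fun u => one_le_radial ha _ _
  have hfq : ∀ u, |f u - q u ^ (-(1 / 4) : ℝ)| ≤ 5 / 8 * q u ^ (-(1 / 4) : ℝ) := by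
    intro u
    have hform := abs_levelForm_le (fun k i j => (hD (k, i, j)).trans (le_abs_self D))
      (abs_le_sqrt_radial ha (T.mulVec (position g u)) u.2) u.2
    have hqD : d ^ 2 * |D| ≤ q u := by
      have h1 : 0 ≤ ∑ i, T.mulVec (position g u) i ^ 2 := Finset.sum_nonneg fun i _ => sq_nonneg _
      have h2 := (le_max_right _ _).trans (haα u.2)
      simp only [hq, radial]
      linarith
    have h0 : 0 < q u := zero_lt_one.trans_le (hq1 u)
    change _ ≤ d ^ 2 * |D| * √(q u) ^ 2 at hform
    rw [Real.sq_sqrt h0.le] at hform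
    have h1 : 0 < q u ^ (-(9 / 4) : ℝ) := Real.rpow_pos_of_pos h0 _
    have h2 : f u - q u ^ (-(1 / 4) : ℝ) =
        5 / 8 * q u ^ (-(9 / 4) : ℝ) * levelForm C (T.mulVec (position g u)) u.2 := by
      simp only [hf, lyapunov, hq]
      ring
    rw [h2, abs_mul, abs_of_pos (by positivity)]
    calc _ ≤ 5 / 8 * q u ^ (-(9 / 4) : ℝ) * (q u * q u) := by
          gcongr
          exact hform.trans (by gcongr)
      _ = 5 / 8 * q u ^ (-(1 / 4) : ℝ) := by
          have : q u ^ (-(1 / 4) : ℝ) = q u ^ (-(9 / 4) : ℝ) * (q u * q u) := by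
            rw [← sq, ← Real.rpow_natCast, ← Real.rpow_add h0]
            norm_num
          rw [this]
          ring
  have hflow : ∀ u, 3 / 8 * q u ^ (-(1 / 4) : ℝ) ≤ f u := fun u => by
    linarith [(abs_le.mp (hfq u)).1]
  have hfup : ∀ u, f u ≤ 13 / 8 * q u ^ (-(1 / 4) : ℝ) := fun u => by
    linarith [(abs_le.mp (hfq u)).2]
  set R := max 1 (max M M') with hR
  have hR0 : 0 < R := zero_lt_one.trans_le (le_max_left _ _)
  -- By the lower bound on f, the inequality f < m forces q ≥ R, the region where the drift
  -- estimates hold.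
  set m := 3 / 8 * R ^ (-(1 / 4) : ℝ) with hm
  have hm0 : 0 < m := by
    have := Real.rpow_pos_of_pos hR0 (-(1 / 4))
    positivity
  obtain ⟨u, hu⟩ : ∃ u, f u < m := by
    have h1 := (tendsto_rpow_neg_atTop (y := 1 / 4) (by norm_num)).eventually
      (gt_mem_nhds (show 0 < m / 2 by positivity))
    obtain ⟨B, hB⟩ := Filter.eventually_atTop.mp h1
    -- Since d > 0 the lattice is infinite, so some point lies outside the finite set where q ≤ B,
    -- and f is small there.
    have : NeZero d := ⟨by omega⟩
    obtain ⟨u, hu⟩ := (finite_radial_le ha hST (g := g) B).exists_notMem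
    simp only [Set.mem_ofPred_eq, not_le] at hu
    refine ⟨u, ?_⟩
    have h2 := hB (q u) hu.le
    have h3 : 0 < q u ^ (-(1 / 4) : ℝ) := Real.rpow_pos_of_pos (zero_lt_one.trans_le (hq1 u)) _
    linarith [hfup u]
  refine hirr.transient_of_superharmonic hfin (f := f) (b := 0) (m := m) (fun v => ?_)
    (fun v hv => ?_) hu
  · have := Real.rpow_pos_of_pos (zero_lt_one.trans_le (hq1 v)) (-(1 / 4))
    linarith [hflow v]
  · have hRq : R ≤ q v := by
      by_contra! hlt
      have := Real.rpow_le_rpow_of_nonpos (zero_lt_one.trans_le (hq1 v)) hlt.le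
        (show (-(1 / 4) : ℝ) ≤ 0 by norm_num)
      linarith [hflow v]
    have hMq : max M M' ≤ q v := (le_max_right _ _).trans hRq
    rw [hf, mean_lyapunov hinv (hfin := hfin)]
    have h1 := hM v.2 _ ((le_max_left _ _).trans hMq)
    have h2 := hM' _ ((le_max_right _ _).trans hMq)
    linarith

end LatticeWalk

theorem theorem1p3 (d N : ℕ) (hN : 1 ≤ N) (p : ThickLattice d N → PMF (ThickLattice d N))
    (hirr : Chain.Irreducible p) (hinv : ThickLattice.Invariant p)
    (hfin : Chain.FinitelySupported p) :
    ∃ ν₀ : PMF (Fin N),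
      (∀ ν : PMF (Fin N), Chain.IsStationary (ThickLattice.levelChain p) ν ↔ ν = ν₀) ∧
      (3 ≤ d → Chain.Transient p) ∧
      (d ≤ 2 → (Chain.Transient p ↔ ThickLattice.drift p ν₀ ≠ 0)) := by
  have : Nonempty (Fin N) := ⟨⟨0, hN⟩⟩
  have hWirr : (LatticeWalk.ofKernel p hfin).LevelIrreducible :=
    (LatticeWalk.isIrreducible_ofKernel hirr hinv).levelIrreducible
  obtain ⟨ν, hν, hν0⟩ := hWirr.exists_stationary
  set ν₀ : PMF (Fin N) := PMF.ofFintype (fun k => ENNReal.ofReal (ν k)) (by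
    rw [← ENNReal.ofReal_sum_of_nonneg fun k _ => (hν0 k).le, hν.1, ENNReal.ofReal_one]) with hν₀
  have hν₀ν : (fun k => (ν₀ k).toReal) = ν := by
    ext k
    rw [hν₀, PMF.ofFintype_apply, ENNReal.toReal_ofReal (hν0 k).le]
  refine ⟨ν₀, fun μ => ?_, fun hd => ?_, fun hd => ?_⟩
  · rw [LatticeWalk.isStationary_levelChain_iff (hfin := hfin)]
    refine ⟨fun hμ => ?_, fun hμ => by rwa [hμ, hν₀ν]⟩
    have h1 := (hWirr.stationary_unique hν hμ).trans hν₀ν.symm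
    ext k
    exact (ENNReal.toReal_eq_toReal_iff' (μ.apply_ne_top k) (ν₀.apply_ne_top k)).mp (congrFun h1 k)
  · by_cases h : (LatticeWalk.ofKernel p hfin).meanStep ν = 0
    · exact LatticeWalk.transient_of_meanStep_eq_zero hirr hinv hν hν0 h hd
    · exact LatticeWalk.transient_of_meanStep_ne_zero hirr hinv hν h
  · rw [LatticeWalk.drift_eq_meanStep (hfin := hfin), hν₀ν]
    refine ⟨fun ht h => ?_, LatticeWalk.transient_of_meanStep_ne_zero hirr hinv hν⟩
    exact LatticeWalk.not_transient_of_meanStep_eq_zero hirr hinv hν hν0 h hd ht
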